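/- **Setting.** Let $\nu$ be a probability law on $(0,\infty)$ with unbounded support and distribution function $F$ (the claim law), let $\overline F=1-F$, and let $m_j=\int z^j\,\nu(dz)$. Consider the classical compound Poisson reserve process $$U_t(u)=u+ct-\sum_{i=1}^{N_t}Z_i ,\qquad u\ge 0,$$ where $c>0$, $(N_t)_{t\ge 0}$ is a Poisson process of intensity $\lambda>0$, and the $Z_i$ are i.i.d. with law $\nu$, independent of $N$. Let $T(u)=\inf\{t\ge 0: U_t(u)<0\}$, $\psi(u)=\mathbb P(T(u)<\infty)$, and let $\theta=\frac{c}{\lambda m_1}-1$ be the safety loading. Put $f_I(x)=\overline F(x)/m_1$ and $\overline{F}_I(x)=1-\frac1{m_1}\int_0^x\overline F(y)\,dy$. For a safety loading $\theta>0$ and a fixed integer $k\ge 2$ consider the assumptions * (A1) there is $R>0$ (depending on $\theta$) with $\int_0^\infty e^{Rx}\frac{f_I(x)}{1+\theta}\,dx=1$; * (A2) $m_k^{\exp}:=\int_0^\infty x^k e^{Rx}\frac{f_I(x)}{1+\theta}\,dx<\infty$; * (A3) $h_I:=\sup_{x\ge 0} f_I(x)/\overline F_I(x)<\infty$. The Cramér–Lundberg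 approximation of $\psi$ is $$\psi^{\mathrm{CL}}(u)=\alpha e^{-Ru},\qquad \alpha=\frac{\theta}{R\int_0^\infty x e^{Rx}f_I(x)\,dx}.$$ **Lemma.** Let $k\ge2$. (i) For all real numbers $\theta_{\max},m_1,m_2,M,H$ there is a constant $C\ge 0$, depending only on these numbers and on $k$, such that for every such model with $0<\theta\le\theta_{\max}$, with the given first two claim moments $m_1,m_2$, satisfying (A1)–(A3) with $m_k^{\exp}\le M$ and $h_I\le H$, and for every $u\ge0$, $$\text{(a)}\quad |\psi(u)-e^{-Ru}|\le C\theta\,e^{-Ru},$$ $$\text{(b)}\quad |\psi(u)-\psi^{\mathrm{CL}}(u)|\le C\theta\,e^{-Ru},$$ $$\text{(c)}\quad \psi(u)>0\quad\text{and}\quad \left|\frac{\psi(u)-\psi^{\mathrm{CL}}(u)}{\psi(u)}\right|\le C\theta .$$ (ii) For every fixed claim law $\nu$ satisfying (A3) and every real $\theta_{\max}$ there is a constant $C\ge 0$ such that, for every model with claim law $\nu$ and $0<\theta\le\theta_{\max}$ which satisfies (A1) and (A2), and for every $u\ge0$, (a) and (b) hold and $\psi(u)>0$; if moreover (A1) and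 (A2) hold for $\nu$ at the safety loading $\theta_{\max}$ itself, then (c) holds too, with the same $C$. -/

import Mathlib

open MeasureTheory ProbabilityTheory Set
open scoped ENNReal NNReal

noncomputable section

namespace RuinTheory

/-! ### Functionals of the claim distribution `ν` -/

/-- A claim distribution: a probability law on `(0, ∞)` with unbounded support. -/
structure IsClaimLaw (ν : Measure ℝ) : Prop where
  isProbabilityMeasure : IsProbabilityMeasure ν
  positive : ν (Iic 0) = 0
  unbounded : ∀ x : ℝ, cdf ν x < 1

/-- The moments `m_j = E(Z₁ ^ j)`. -/
def claimMoment (ν : Measure ℝ) (j : ℕ) : ℝ := ∫ z, z ^ j ∂ν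

/-- The survival function `1 - F`. -/
def claimTail (ν : Measure ℝ) (x : ℝ) : ℝ := 1 - cdf ν x

/-- The integrated tail distribution function `F_I(x) = (1 / m₁) ∫₀ˣ (1 - F(y)) dy`. -/
def integratedTailCdf (ν : Measure ℝ) (x : ℝ) : ℝ :=
  (1 / claimMoment ν 1) * ∫ y in (0 : ℝ)..x, claimTail ν y

/-- The density `f_I(x) = (1 - F(x)) / m₁` of the integrated tail distribution. -/
def integratedTailDensity (ν : Measure ℝ) (x : ℝ) : ℝ :=
  claimTail ν x / claimMoment ν 1

/-- The hazard rate `f_I(x) / (1 - F_I(x))` of the integrated tail distribution. -/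
def hazardRate (ν : Measure ℝ) (x : ℝ) : ℝ :=
  integratedTailDensity ν x / (1 - integratedTailCdf ν x)

/-- The supremum `h_I` of the hazard rate over `x ≥ 0` (meaningful when it is bounded above). -/
def hazardSup (ν : Measure ℝ) : ℝ := sSup (hazardRate ν '' Ici 0)

/-- `R > 0` is an adjustment coefficient for the claim law `ν` and the safety loading `θ`:
`∫₀^∞ exp(R x) f_I(x) / (1 + θ) dx = 1`. -/
def IsAdjustmentCoefficient (ν : Measure ℝ) (θ R : ℝ) : Prop :=
  0 < R ∧
    ∫ x in Ioi (0 : ℝ), Real.exp (R * x) * (integratedTailDensity ν x / (1 + θ)) = 1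

/-- The integral `∫₀^∞ x^k exp(R x) f_I(x) / (1 + θ) dx` converges. -/
def HasExpMoment (ν : Measure ℝ) (θ R : ℝ) (k : ℕ) : Prop :=
  IntegrableOn (fun x : ℝ => x ^ k * Real.exp (R * x) * (integratedTailDensity ν x / (1 + θ)))
    (Ioi 0)

/-- `m_k^exp = ∫₀^∞ x^k exp(R x) f_I(x) / (1 + θ) dx`. -/
def expMoment (ν : Measure ℝ) (θ R : ℝ) (k : ℕ) : ℝ :=
  ∫ x in Ioi (0 : ℝ), x ^ k * Real.exp (R * x) * (integratedTailDensity ν x / (1 + θ))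

/-- The hazard rate of the integrated tail distribution is bounded on `[0, ∞)`. -/
def HasBoundedHazard (ν : Measure ℝ) : Prop := BddAbove (hazardRate ν '' Ici 0)

/-! ### The compound Poisson reserve process -/

/-- The data of a classical compound Poisson risk model with claim law `ν`: a premium rate
`c > 0`, an intensity `lam > 0`, the successive waiting times `W 0, W 1, …` between claims (i.i.d.
exponential of rate `lam`; the associated counting process is the Poisson process of intensity
`lam`) and the claim costs `Z 0, Z 1, …` (i.i.d. of law `ν`), all of them independent. -/
structure RiskModel {Ω : Type*} [MeasurableSpace Ω] (P : Measure Ω) (ν : Measure ℝ) where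
  c : ℝ
  c_pos : 0 < c
  lam : ℝ
  lam_pos : 0 < lam
  W : ℕ → Ω → ℝ
  Z : ℕ → Ω → ℝ
  measurable_W : ∀ i, Measurable (W i)
  measurable_Z : ∀ i, Measurable (Z i)
  law_W : ∀ i, P.map (W i) = expMeasure lam
  law_Z : ∀ i, P.map (Z i) = ν
  indep : iIndepFun (Sum.elim W Z) P

namespace RiskModel

variable {Ω : Type*} [MeasurableSpace Ω] {P : Measure Ω} {ν : Measure ℝ}

/-- The time `W 0 + ⋯ + W n` of the claim number `n` (claims are numbered from `0`). -/
def claimTime (X : RiskModel P ν) (n : ℕ) (ω : Ω) : ℝ := ∑ i ∈ Finset.range (n + 1), X.W i ω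

/-- The Poisson process `N_t`: the number of claims that occur until time `t`. -/
def claimCount (X : RiskModel P ν) (t : ℝ≥0) (ω : Ω) : ℕ :=
  {n : ℕ | X.claimTime n ω ≤ t}.ncard

/-- The reserve `U_t(u) = u + c t - (Z 0 + ⋯ + Z (N_t - 1))`. -/
def reserve (X : RiskModel P ν) (u : ℝ) (t : ℝ≥0) (ω : Ω) : ℝ :=
  u + X.c * t - ∑ i ∈ Finset.range (X.claimCount t ω), X.Z i ω

/-- The time of ruin `T(u) = inf {t ≥ 0 : U_t(u) < 0}`, with `inf ∅ = ∞`. -/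
def ruinTime (X : RiskModel P ν) (u : ℝ) (ω : Ω) : ℝ≥0∞ :=
  ⨅ (t : ℝ≥0) (_ : X.reserve u t ω < 0), (t : ℝ≥0∞)

/-- The ruin probability `ψ(u) = P(T(u) < ∞)`. -/
def ruinProb (X : RiskModel P ν) (u : ℝ) : ℝ := P.real {ω | X.ruinTime u ω < ∞}

/-- The safety loading coefficient `θ = c / (lam m₁) - 1`. -/
def safetyLoading (X : RiskModel P ν) : ℝ := X.c / (X.lam * claimMoment ν 1) - 1

/-- The Cramér–Lundberg approximation `ψ^CL(u) = α exp(-R u)`, with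
`α = θ / (R ∫₀^∞ x exp(R x) f_I(x) dx)`. -/
def cramerLundberg (X : RiskModel P ν) (R u : ℝ) : ℝ :=
  X.safetyLoading / (R * ∫ x in Ioi (0 : ℝ), x * Real.exp (R * x) * integratedTailDensity ν x) *
    Real.exp (-R * u)

end RiskModel

end RuinTheory

end

/-! Ruin can only happen at a claim, so `ψ(u)` is the probability that the random walk with steps `Z
- cW` exceeds `u`. Conditioning on the first claim gives an integral equation for `ψ`, which turns
into the renewal equation `ψ(u) = (λ/c) ∫₀^∞ ψ(u - x) (1 - F(x)) dx`, with `ψ = 1` on the negative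
axis.

Multiplication by `exp(Ru)` tilts the kernel into a probability law `γ`, with density `exp(Rx)
f_I(x)/(1+θ)`. Thus `Φ(u) = exp(Ru) ψ(u)` satisfies `Φ(u) = ∫ Φ(u - y) γ(dy)` for `u ≥ 0` and `Φ(x)
= exp(Rx)` for `x < 0`. Probabilistically, `Φ(u)` is the mean of `exp(-R · overshoot)` for the
renewal process with step law `γ` crossing level `u`. Hence `Φ ≤ 1` (Lundberg's inequality,
`ruinBefore_le_exp`), and by Jensen `Φ(u) ≥ exp(-RL)` as soon as `L` bounds the mean overshoot. A
bound of Lorden's type, `L = 5 E_γ Y² / E_γ Y`, is enough. It is obtained analytically, from an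
explicit supersolution (`integral_overshootBound_sub_le`) and a maximum principle
(`exp_neg_le_of_renewal`).

It remains to see that `RL = O(θ)`. Integrating elementary inequalities for `exp(-RY)` against `γ`
gives `R ≤ 2 m₁ θ / m₂` and `E_γ Y ≥ m₂ / (2 m₁ (1+θ))`, while `E_γ Y² ≤ 1 + m_k^exp`
(`mul_ratio_le`). Similarly `θ/(1+θ) = E_γ(1 - exp(-RY))` places `α` between `1 - RL` and `1`. Thus
`ψ` and `ψ^CL` both lie between `(1 - Kθ) exp(-Ru)` and `exp(-Ru)`, and the relative error follows
from `ψ(u) ≥ exp(-Kθ) exp(-Ru)`.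

For a fixed claim law, `R` is monotone in `θ`, so the tilted moment at one loading `θ₀` controls
those at all smaller loadings. For `θ > θ₀` the absolute bounds are trivial once `C ≥ 1/θ₀`. -/

namespace RuinTheory

/-! ### A bounded supersolution of the overshoot equation -/

section Overshoot

variable {γ : Measure ℝ}

/-- A bounded supersolution of the equation satisfied by the mean overshoot of a renewal process
with step law `γ`; it is `-x` at `x < 0`. -/
noncomputable def overshootBound (γ : Measure ℝ) (x : ℝ) : ℝ :=
  if x < 0 then -x
  else 5 * (∫ y, y ^ 2 ∂γ) / (∫ y, y ∂γ) - (∫ y, (max (y - x) 0) ^ 2 ∂γ) / ∫ y, y ∂γ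

theorem integrable_id_of_integrable_sq [IsFiniteMeasure γ]
    (h2 : Integrable (fun y : ℝ => y ^ 2) γ) : Integrable (fun y : ℝ => y) γ := by
  refine ((integrable_const (1 : ℝ)).add h2).mono' measurable_id.aestronglyMeasurable ?_
  refine Filter.Eventually.of_forall fun y => ?_
  simp only [Real.norm_eq_abs, Pi.add_apply]
  nlinarith [sq_abs y, sq_nonneg (|y| - 1)]

theorem integrable_max_sub [IsFiniteMeasure γ] (h1 : Integrable (fun y : ℝ => y) γ) (x : ℝ) :
    Integrable (fun y : ℝ => max (y - x) 0) γ :=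
  (h1.sub (integrable_const x)).sup (integrable_const 0)

theorem integrable_max_sub_sq [IsFiniteMeasure γ] (h2 : Integrable (fun y : ℝ => y ^ 2) γ)
    (x : ℝ) : Integrable (fun y : ℝ => (max (y - x) 0) ^ 2) γ := by
  refine ((h2.const_mul 2).add (integrable_const (2 * x ^ 2))).mono'
    (by fun_prop) (Filter.Eventually.of_forall fun y => ?_)
  simp only [Real.norm_eq_abs, Pi.add_apply]
  rw [abs_of_nonneg (sq_nonneg _)]
  rcases max_cases (y - x) 0 with ⟨h, -⟩ | ⟨h, -⟩ <;> rw [h]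
  · nlinarith [sq_nonneg (y + x)]
  · nlinarith [sq_nonneg x, sq_nonneg y]

theorem antitone_integral_max_sub_sq [IsFiniteMeasure γ]
    (h2 : Integrable (fun y : ℝ => y ^ 2) γ) :
    Antitone fun x : ℝ => ∫ y, (max (y - x) 0) ^ 2 ∂γ := fun a b hab =>
  integral_mono (integrable_max_sub_sq h2 b) (integrable_max_sub_sq h2 a) fun y =>
    pow_le_pow_left₀ (le_max_right _ _) (max_le_max (by linarith) le_rfl) 2

theorem measurable_overshootBound [IsFiniteMeasure γ]
    (h2 : Integrable (fun y : ℝ => y ^ 2) γ) : Measurable (overshootBound γ) := by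
  unfold overshootBound
  refine Measurable.ite measurableSet_Iio measurable_neg ?_
  exact measurable_const.sub ((antitone_integral_max_sub_sq h2).measurable.div_const _)

theorem integral_max_sub_sq_le [IsFiniteMeasure γ] (hpos : ∀ᵐ y ∂γ, 0 < y)
    (h2 : Integrable (fun y : ℝ => y ^ 2) γ) {x : ℝ} (hx : 0 ≤ x) :
    ∫ y, (max (y - x) 0) ^ 2 ∂γ ≤ ∫ y, y ^ 2 ∂γ := by
  refine integral_mono_ae (integrable_max_sub_sq h2 x) h2 ?_
  filter_upwards [hpos] with y hy
  exact pow_le_pow_left₀ (le_max_right _ _) (max_le (by linarith) hy.le) 2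

theorem overshootBound_le (hm : 0 < ∫ y, y ∂γ) {x : ℝ} (hx : 0 ≤ x) :
    overshootBound γ x ≤ 5 * (∫ y, y ^ 2 ∂γ) / (∫ y, y ∂γ) := by
  rw [overshootBound, if_neg hx.not_gt]
  have : 0 ≤ (∫ y, (max (y - x) 0) ^ 2 ∂γ) / ∫ y, y ∂γ :=
    div_nonneg (integral_nonneg fun _ => sq_nonneg _) hm.le
  linarith

theorem le_overshootBound [IsFiniteMeasure γ] (hpos : ∀ᵐ y ∂γ, 0 < y) (hm : 0 < ∫ y, y ∂γ)
    (h2 : Integrable (fun y : ℝ => y ^ 2) γ) {x : ℝ} (hx : 0 ≤ x) :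
    4 * (∫ y, y ^ 2 ∂γ) / (∫ y, y ∂γ) ≤ overshootBound γ x := by
  rw [overshootBound, if_neg hx.not_gt]
  have := div_le_div_of_nonneg_right (integral_max_sub_sq_le hpos h2 hx) hm.le
  rw [mul_div_assoc]
  rw [mul_div_assoc]
  linarith

theorem overshootBound_nonneg [IsFiniteMeasure γ] (hpos : ∀ᵐ y ∂γ, 0 < y) (hm : 0 < ∫ y, y ∂γ)
    (h2 : Integrable (fun y : ℝ => y ^ 2) γ) (x : ℝ) : 0 ≤ overshootBound γ x := by
  rcases lt_or_ge x 0 with hx | hx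
  · rw [overshootBound, if_pos hx]; linarith
  · exact (div_nonneg (mul_nonneg (by norm_num) (integral_nonneg fun _ => sq_nonneg _))
      hm.le).trans (le_overshootBound hpos hm h2 hx)

theorem integrable_overshootBound_sub [IsFiniteMeasure γ] (hpos : ∀ᵐ y ∂γ, 0 < y)
    (hm : 0 < ∫ y, y ∂γ) (h2 : Integrable (fun y : ℝ => y ^ 2) γ) (u : ℝ) :
    Integrable (fun y => overshootBound γ (u - y)) γ := by
  have h1 := integrable_id_of_integrable_sq h2
  refine ((integrable_const (5 * (∫ y, y ^ 2 ∂γ) / (∫ y, y ∂γ) + |u|)).add h1.abs).mono'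
    ((measurable_overshootBound h2).comp (by fun_prop)).aestronglyMeasurable
    (Filter.Eventually.of_forall fun y => ?_)
  have hL : 0 ≤ 5 * (∫ y, y ^ 2 ∂γ) / (∫ y, y ∂γ) :=
    div_nonneg (mul_nonneg (by norm_num) (integral_nonneg fun _ => sq_nonneg _)) hm.le
  simp only [Real.norm_eq_abs, Pi.add_apply]
  rw [abs_of_nonneg (overshootBound_nonneg hpos hm h2 _)]
  rcases lt_or_ge (u - y) 0 with hx | hx
  · rw [overshootBound, if_pos hx]
    linarith [neg_abs_le u, le_abs_self y]
  · linarith [overshootBound_le hm hx, abs_nonneg u, abs_nonneg y]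

/-- On `y ≤ u`, convexity of the squared positive part gives a decrease of at least `2ky/m`, where
`k = E(Y - u)₊`. On `y > u` the value is `y - u`, while `overshootBound γ u` is at least `4s/m`. The
contribution `k` of the overshoot is then paid for by the total decrease `2k`, up to an error on `{Y
> u}` that the reserve `4s/m` absorbs. -/
theorem integral_overshootBound_sub_le [IsProbabilityMeasure γ] (hpos : ∀ᵐ y ∂γ, 0 < y)
    (hm : 0 < ∫ y, y ∂γ) (h2 : Integrable (fun y : ℝ => y ^ 2) γ) {u : ℝ} (hu : 0 ≤ u) :
    ∫ y, overshootBound γ (u - y) ∂γ ≤ overshootBound γ u := by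
  have h1 := integrable_id_of_integrable_sq h2
  set m := ∫ y, y ∂γ with hm_def
  set s := ∫ y, y ^ 2 ∂γ with hs_def
  set k := ∫ y, max (y - u) 0 ∂γ with hk_def
  set G := ∫ y, (Ioi u).indicator (fun _ => (1 : ℝ)) y ∂γ with hG_def
  set e₂ := ∫ y, (Ioi u).indicator (fun y => y) y ∂γ with he₂_def
  have iG : Integrable ((Ioi u).indicator fun _ => (1 : ℝ)) γ :=
    (integrable_const 1).indicator measurableSet_Ioi
  have ie : Integrable ((Ioi u).indicator fun y : ℝ => y) γ := h1.indicator measurableSet_Ioi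
  have ik := integrable_max_sub h1 u
  have hs0 : 0 ≤ s := integral_nonneg fun _ => sq_nonneg _
  have hk0 : 0 ≤ k := integral_nonneg fun _ => le_max_right _ _
  have hkm : k ≤ m := integral_mono_ae ik h1 <| by
    filter_upwards [hpos] with y hy
    exact max_le (by linarith) hy.le
  -- The variance is nonnegative, so `s ≥ m² > 0`.
  have hspos : 0 < s := by
    have : m ^ 2 ≤ s := by
      have h := integral_nonneg (μ := γ) (f := fun y : ℝ => (y - m) ^ 2) fun _ => sq_nonneg _
      have e : ∫ y, (y - m) ^ 2 ∂γ = s - m ^ 2 := by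
        have : (fun y : ℝ => (y - m) ^ 2) = fun y => y ^ 2 - (2 * m) * y + m ^ 2 := by
          ext y; ring
        have i : Integrable (fun y : ℝ => y ^ 2 - (2 * m) * y) γ := h2.sub (h1.const_mul _)
        rw [this, integral_add i (integrable_const _), integral_sub h2 (h1.const_mul _),
          integral_const_mul, ← hm_def, ← hs_def]
        simp; ring
      linarith
    exact (pow_pos hm 2).trans_le this
  -- Arithmetic-geometric mean inequality: `y ≤ (m/4s) y² + s/m`, applied on `{y > u}` only.
  have he₂ : e₂ ≤ m / 4 + s / m * G := by
    have h : e₂ ≤ ∫ y, (m / (4 * s) * y ^ 2 + s / m * (Ioi u).indicator (fun _ => (1 : ℝ)) y) ∂γ := by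
      refine integral_mono ie ((h2.const_mul _).add (iG.const_mul _)) fun y => ?_
      by_cases hy : y ∈ Ioi u
      · simp only [indicator_of_mem hy, mul_one]
        have e : m / (4 * s) * y ^ 2 + s / m - y = (m * y - 2 * s) ^ 2 / (4 * s * m) := by
          field_simp; ring
        have : 0 ≤ (m * y - 2 * s) ^ 2 / (4 * s * m) := by positivity
        linarith
      · simp only [indicator_of_notMem hy]
        positivity
    rw [integral_add (h2.const_mul _) (iG.const_mul _), integral_const_mul, integral_const_mul,
      ← hs_def, ← hG_def] at h
    have : m / (4 * s) * s = m / 4 := by field_simp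
    linarith
  have i₁ : Integrable (fun y => overshootBound γ u - 2 / m * k * y) γ :=
    (integrable_const _).sub (h1.const_mul _)
  have i₂ : Integrable (fun y => overshootBound γ u - 2 / m * k * y
      + 2 / m * k * (Ioi u).indicator (fun y => y) y) γ := i₁.add (ie.const_mul _)
  have i₃ : Integrable (fun y => overshootBound γ u - 2 / m * k * y
      + 2 / m * k * (Ioi u).indicator (fun y => y) y + max (y - u) 0) γ := i₂.add ik
  have key : ∫ y, overshootBound γ (u - y) ∂γ ≤
      ∫ y, (overshootBound γ u - 2 / m * k * y
        + 2 / m * k * (Ioi u).indicator (fun y => y) y + max (y - u) 0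
        - 4 * s / m * (Ioi u).indicator (fun _ => (1 : ℝ)) y) ∂γ := by
    refine integral_mono_ae (integrable_overshootBound_sub hpos hm h2 u)
      (i₃.sub (iG.const_mul _)) ?_
    filter_upwards [hpos] with y hy
    by_cases hyu : y ∈ Ioi u
    · simp only [indicator_of_mem hyu, mul_one]
      have hyu' : u < y := hyu
      have h3 : overshootBound γ (u - y) = y - u := by
        rw [overshootBound, if_pos (by linarith)]; ring
      rw [h3, max_eq_left (by linarith)]
      linarith [le_overshootBound hpos hm h2 hu]
    · simp only [indicator_of_notMem hyu, mul_zero, add_zero, sub_zero]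
      have hyu' : y ≤ u := not_lt.1 hyu
      rw [max_eq_right (by linarith), add_zero, overshootBound, overshootBound,
        if_neg (by linarith), if_neg (by linarith)]
      -- For `x > u` the square `(x - u + y)²` exceeds `(x - u)²` by `2y(x - u) + y²`; the last term
      -- is dropped.
      have h3 : (∫ x, (max (x - u) 0) ^ 2 ∂γ) + 2 * y * k ≤
          ∫ x, (max (x - (u - y)) 0) ^ 2 ∂γ := by
        rw [hk_def, ← integral_const_mul, ← integral_add (integrable_max_sub_sq h2 u)
          (ik.const_mul _)]
        refine integral_mono ((integrable_max_sub_sq h2 u).add (ik.const_mul _))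
          (integrable_max_sub_sq h2 _) fun x => ?_
        simp only
        rcases max_cases (x - u) 0 with ⟨h, h'⟩ | ⟨h, h'⟩
        · rw [h, max_eq_left (by linarith)]
          nlinarith [sq_nonneg y]
        · rw [h]; nlinarith [sq_nonneg (max (x - (u - y)) 0)]
      have h4 := div_le_div_of_nonneg_right h3 hm.le
      rw [add_div] at h4
      have : 2 / m * k * y = 2 * y * k / m := by ring
      rw [this]
      linarith
  refine key.trans ?_
  rw [integral_sub i₃ (iG.const_mul _), integral_add i₂ ik, integral_add i₁ (ie.const_mul _),
    integral_sub (integrable_const _) (h1.const_mul _), integral_const_mul, integral_const_mul,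
    integral_const_mul, ← hm_def, ← hk_def, ← hG_def, ← he₂_def]
  simp only [integral_const, probReal_univ, one_smul]
  have h5 : 2 / m * k * m = 2 * k := by field_simp
  have h6 : 4 * s / m * G = 4 * (s / m * G) := by ring
  have h7 : 2 / m * k * e₂ ≤ k + 4 * (s / m * G) := by
    have h8 : 0 ≤ s / m * G := by
      have : 0 ≤ G := integral_nonneg fun y => indicator_nonneg (fun _ _ => zero_le_one) y
      positivity
    have h9 : 2 / m * k ≤ 2 := by
      rw [div_mul_eq_mul_div, div_le_iff₀ hm]; linarith
    have h10 : 0 ≤ 2 / m * k := by positivity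
    calc 2 / m * k * e₂ ≤ 2 / m * k * (m / 4 + s / m * G) := by gcongr
      _ = k / 2 + 2 / m * k * (s / m * G) := by field_simp; ring
      _ ≤ k / 2 + 2 * (s / m * G) := by gcongr
      _ ≤ _ := by linarith
  linarith

end Overshoot

/-- Comparison for the renewal equation with boundary values `exp (R x)` at `x < 0`: its solutions
are at least `exp (-R L)`, where `L` is five times the ratio of the first two moments. -/
theorem exp_neg_le_of_renewal {γ : Measure ℝ} [IsProbabilityMeasure γ] (hpos : ∀ᵐ y ∂γ, 0 < y)
    (hm : 0 < ∫ y, y ∂γ) (h2 : Integrable (fun y : ℝ => y ^ 2) γ)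
    (hunb : ∀ x, γ.real (Iic x) < 1) {R : ℝ} (hR : 0 ≤ R) {Φ : ℝ → ℝ} (hΦm : Measurable Φ)
    (hΦneg : ∀ x < 0, Φ x = Real.exp (R * x)) (hΦ0 : ∀ x, 0 ≤ Φ x) (hΦ1 : ∀ x, Φ x ≤ 1)
    (hΦ : ∀ u, 0 ≤ u → Φ u = ∫ y, Φ (u - y) ∂γ) {u : ℝ} (hu : 0 ≤ u) :
    Real.exp (-(R * (5 * (∫ y, y ^ 2 ∂γ) / (∫ y, y ∂γ)))) ≤ Φ u := by
  set L := 5 * (∫ y, y ^ 2 ∂γ) / (∫ y, y ∂γ) with hL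
  -- The first term replaces `exp` by its tangent at `-RL`, evaluated at `-R` times the overshoot
  -- bound. By convexity it stays below the boundary values `exp(Rx)` at `x < 0`.
  set d : ℝ → ℝ := fun x =>
    Real.exp (-(R * L)) * (1 + R * L - R * overshootBound γ x) - Φ x with hd
  have hdneg : ∀ x < 0, d x ≤ 0 := by
    intro x hx
    simp only [hd, hΦneg x hx, overshootBound, if_pos hx]
    have h := Real.add_one_le_exp (R * x + R * L)
    have h' : Real.exp (R * x) = Real.exp (-(R * L)) * Real.exp (R * x + R * L) := by
      rw [← Real.exp_add]; ring_nf
    rw [h', sub_nonpos]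
    gcongr
    linarith
  have hLnn : 0 ≤ R * L :=
    mul_nonneg hR (div_nonneg (mul_nonneg (by norm_num) (integral_nonneg fun _ => sq_nonneg _))
      hm.le)
  have hdle : ∀ x, d x ≤ 1 + R * L := by
    intro x
    have h1 : 0 ≤ R * overshootBound γ x := mul_nonneg hR (overshootBound_nonneg hpos hm h2 x)
    have h2' : Real.exp (-(R * L)) ≤ 1 := Real.exp_le_one_iff.2 (by linarith)
    have h3 : Real.exp (-(R * L)) * (1 + R * L - R * overshootBound γ x) ≤ 1 + R * L :=
      calc _ ≤ Real.exp (-(R * L)) * (1 + R * L) := by gcongr; linarith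
        _ ≤ 1 * (1 + R * L) := by gcongr
        _ = _ := one_mul _
    have := hΦ0 x
    simp only [hd]; linarith
  have iΦ : ∀ v, Integrable (fun y => Φ (v - y)) γ := fun v =>
    (integrable_const (1 : ℝ)).mono' (hΦm.comp (by fun_prop)).aestronglyMeasurable
      (Filter.Eventually.of_forall fun y => by
        rw [Real.norm_eq_abs, abs_of_nonneg (hΦ0 _)]; exact hΦ1 _)
  have iB := integrable_overshootBound_sub hpos hm h2
  have isub : ∀ v, Integrable (fun y =>
      Real.exp (-(R * L)) * (1 + R * L - R * overshootBound γ (v - y))) γ := fun v =>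
    ((integrable_const _).sub ((iB v).const_mul R)).const_mul _
  have hsub : ∀ v, 0 ≤ v → d v ≤ ∫ y, d (v - y) ∂γ := by
    intro v hv
    have h := integral_overshootBound_sub_le hpos hm h2 hv
    simp only [hd]
    rw [integral_sub (isub v) (iΦ v), ← hΦ v hv, integral_const_mul,
      integral_sub (integrable_const _) ((iB v).const_mul R), integral_const_mul]
    simp only [integral_const, probReal_univ, one_smul]
    gcongr
  -- Maximum principle: a positive supremum `D` of `d` on `[0, u]` would satisfy `D ≤ D γ((-∞, u])`,
  -- although the steps exceed `u` with positive probability.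
  have hdu : d u ≤ 0 := by
    by_contra! hcon
    have hbdd : BddAbove (d '' Icc 0 u) := ⟨1 + R * L, by rintro _ ⟨x, -, rfl⟩; exact hdle x⟩
    have hmemu : d u ∈ d '' Icc 0 u := ⟨u, ⟨hu, le_rfl⟩, rfl⟩
    set D := sSup (d '' Icc 0 u) with hD
    have hD0 : 0 < D := hcon.trans_le (le_csSup hbdd hmemu)
    have hle : D ≤ D * γ.real (Iic u) := by
      refine csSup_le ⟨_, hmemu⟩ ?_
      rintro _ ⟨v, ⟨hv0, hvu⟩, rfl⟩
      refine (hsub v hv0).trans ?_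
      calc ∫ y, d (v - y) ∂γ ≤ ∫ y, (Iic u).indicator (fun _ => D) y ∂γ := by
            refine integral_mono_ae ((isub v).sub (iΦ v))
              ((integrable_const D).indicator measurableSet_Iic) ?_
            filter_upwards [hpos] with y hy
            change d (v - y) ≤ _
            rcases lt_or_ge (v - y) 0 with h | h
            · exact (hdneg _ h).trans (indicator_nonneg (fun _ _ => hD0.le) _)
            · rw [indicator_of_mem (show y ∈ Iic u by simp; linarith)]
              exact le_csSup hbdd ⟨v - y, ⟨h, by linarith⟩, rfl⟩
        _ = D * γ.real (Iic u) := by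
            rw [integral_indicator measurableSet_Iic]; simp [mul_comm]
    nlinarith [hunb u]
  have hb : R * overshootBound γ u ≤ R * L :=
    mul_le_mul_of_nonneg_left (overshootBound_le hm hu) hR
  have : Real.exp (-(R * L)) * 1 ≤
      Real.exp (-(R * L)) * (1 + R * L - R * overshootBound γ u) := by
    gcongr; linarith
  simp only [hd] at hdu
  linarith

/-! ### The ruin probability as a limit of finite-horizon ruin probabilities -/

/-- The probability that ruin occurs at one of the first `n` claims, for waiting times of law `κ`
and claims of law `ν`; it is `1` for a negative initial reserve. -/
noncomputable def ruinBefore (c : ℝ) (κ ν : Measure ℝ) : ℕ → ℝ → ℝ≥0∞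
  | 0, u => if u < 0 then 1 else 0
  | n + 1, u => if u < 0 then 1 else ∫⁻ z, ∫⁻ w, ruinBefore c κ ν n (u - z + c * w) ∂κ ∂ν

/-- The limit of the finite-horizon ruin probabilities. -/
noncomputable def ruinLimit (c : ℝ) (κ ν : Measure ℝ) (u : ℝ) : ℝ≥0∞ :=
  ⨆ n, ruinBefore c κ ν n u

section Recursion

variable {c : ℝ} {κ ν : Measure ℝ}

theorem ruinBefore_of_neg (n : ℕ) {u : ℝ} (hu : u < 0) : ruinBefore c κ ν n u = 1 := by
  cases n <;> simp [ruinBefore, hu]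

theorem ruinBefore_succ (n : ℕ) {u : ℝ} (hu : 0 ≤ u) :
    ruinBefore c κ ν (n + 1) u = ∫⁻ z, ∫⁻ w, ruinBefore c κ ν n (u - z + c * w) ∂κ ∂ν := by
  simp [ruinBefore, hu.not_gt]

theorem ruinBefore_le_one [IsProbabilityMeasure κ] [IsProbabilityMeasure ν] (n : ℕ) (u : ℝ) :
    ruinBefore c κ ν n u ≤ 1 := by
  induction n generalizing u with
  | zero => simp only [ruinBefore]; split_ifs <;> simp
  | succ n ih =>
    rcases lt_or_ge u 0 with hu | hu
    · rw [ruinBefore_of_neg _ hu]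
    · rw [ruinBefore_succ n hu]
      calc _ ≤ ∫⁻ _, ∫⁻ _, 1 ∂κ ∂ν := lintegral_mono fun z => lintegral_mono fun w => ih _
        _ = 1 := by simp

theorem ruinBefore_antitone [IsProbabilityMeasure κ] [IsProbabilityMeasure ν] (n : ℕ) :
    Antitone (ruinBefore c κ ν n) := by
  induction n with
  | zero =>
    intro u v huv
    simp only [ruinBefore]
    split_ifs <;> first | linarith | simp
  | succ n ih =>
    intro u v huv
    rcases lt_or_ge u 0 with hu | hu
    · rw [ruinBefore_of_neg _ hu]; exact ruinBefore_le_one _ _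
    · rw [ruinBefore_succ n hu, ruinBefore_succ n (hu.trans huv)]
      exact lintegral_mono fun z => lintegral_mono fun w => ih (by linarith)

theorem ruinBefore_monotone (u : ℝ) : Monotone fun n => ruinBefore c κ ν n u := by
  refine monotone_nat_of_le_succ fun n => ?_
  induction n generalizing u with
  | zero =>
    rcases lt_or_ge u 0 with hu | hu
    · rw [ruinBefore_of_neg _ hu, ruinBefore_of_neg _ hu]
    · simp [ruinBefore, hu.not_gt]
  | succ n ih =>
    rcases lt_or_ge u 0 with hu | hu
    · rw [ruinBefore_of_neg _ hu, ruinBefore_of_neg _ hu]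
    · rw [ruinBefore_succ n hu, ruinBefore_succ (n + 1) hu]
      exact lintegral_mono fun z => lintegral_mono fun w => ih _

/-- Lundberg's inequality: `exp(-Ru)` dominates the initial indicator, and `hR` makes it a
supersolution of the recursion. -/
theorem ruinBefore_le_exp {R : ℝ}
    (hR : ∫⁻ z, ∫⁻ w, ENNReal.ofReal (Real.exp (R * (z - c * w))) ∂κ ∂ν ≤ 1) (hR0 : 0 ≤ R)
    (n : ℕ) (u : ℝ) : ruinBefore c κ ν n u ≤ ENNReal.ofReal (Real.exp (-R * u)) := by
  have hneg : ∀ n u, u < 0 → ruinBefore c κ ν n u ≤ ENNReal.ofReal (Real.exp (-R * u)) := by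
    intro n u hu
    rw [ruinBefore_of_neg _ hu, ENNReal.one_le_ofReal, Real.one_le_exp_iff]
    nlinarith
  induction n generalizing u with
  | zero =>
    rcases lt_or_ge u 0 with hu | hu
    · exact hneg 0 u hu
    · simp [ruinBefore, hu.not_gt]
  | succ n ih =>
    rcases lt_or_ge u 0 with hu | hu
    · exact hneg _ u hu
    · rw [ruinBefore_succ n hu]
      calc _ ≤ ∫⁻ z, ∫⁻ w, ENNReal.ofReal (Real.exp (-R * u)) *
              ENNReal.ofReal (Real.exp (R * (z - c * w))) ∂κ ∂ν := by
            refine lintegral_mono fun z => lintegral_mono fun w => (ih _).trans_eq ?_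
            rw [← ENNReal.ofReal_mul (Real.exp_nonneg _), ← Real.exp_add]
            ring_nf
        _ = ENNReal.ofReal (Real.exp (-R * u)) *
              ∫⁻ z, ∫⁻ w, ENNReal.ofReal (Real.exp (R * (z - c * w))) ∂κ ∂ν := by
            simp_rw [lintegral_const_mul' _ _ ENNReal.ofReal_ne_top]
        _ ≤ _ := mul_le_of_le_one_right' hR

theorem ruinLimit_of_neg {u : ℝ} (hu : u < 0) : ruinLimit c κ ν u = 1 := by
  simp [ruinLimit, ruinBefore_of_neg _ hu]

theorem ruinLimit_le_exp {R : ℝ}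
    (hR : ∫⁻ z, ∫⁻ w, ENNReal.ofReal (Real.exp (R * (z - c * w))) ∂κ ∂ν ≤ 1) (hR0 : 0 ≤ R)
    (u : ℝ) : ruinLimit c κ ν u ≤ ENNReal.ofReal (Real.exp (-R * u)) :=
  iSup_le fun n => ruinBefore_le_exp hR hR0 n u

variable [IsProbabilityMeasure κ] [IsProbabilityMeasure ν]

theorem ruinLimit_le_one (u : ℝ) : ruinLimit c κ ν u ≤ 1 :=
  iSup_le fun n => ruinBefore_le_one n u

theorem ruinLimit_antitone : Antitone (ruinLimit c κ ν) := fun _ _ h =>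
  iSup_mono fun n => ruinBefore_antitone n h

theorem ruinLimit_eq_lintegral {u : ℝ} (hu : 0 ≤ u) :
    ruinLimit c κ ν u = ∫⁻ z, ∫⁻ w, ruinLimit c κ ν (u - z + c * w) ∂κ ∂ν := by
  have hm : ∀ n, Measurable (ruinBefore c κ ν n) := fun n => (ruinBefore_antitone n).measurable
  have h1 : ruinLimit c κ ν u = ⨆ n, ruinBefore c κ ν (n + 1) u :=
    ((ruinBefore_monotone u).iSup_nat_add 1).symm
  simp only [h1, ruinBefore_succ _ hu]
  rw [← lintegral_iSup]
  · refine lintegral_congr fun z => ?_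
    exact (lintegral_iSup (μ := κ) (f := fun n w => ruinBefore c κ ν n (u - z + c * w))
      (fun n => (hm n).comp (by fun_prop)) fun i j hij w => ruinBefore_monotone _ hij).symm
  · intro n
    refine Measurable.lintegral_prod_right' (f := fun p : ℝ × ℝ =>
      ruinBefore c κ ν n (u - p.1 + c * p.2)) ((hm n).comp (by fun_prop))
  · intro i j hij z
    exact lintegral_mono fun w => ruinBefore_monotone _ hij

end Recursion

/-! ### The recursion computes crossing probabilities of the claim random walk -/

section RandomWalk

variable {Ω : Type*} [MeasurableSpace Ω] {P : Measure Ω} {c : ℝ} {κ ν : Measure ℝ}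

theorem indepFun_head_tail {W Z : ℕ → Ω → ℝ} (hW : ∀ i, Measurable (W i))
    (hZ : ∀ i, Measurable (Z i)) (hind : iIndepFun (Sum.elim W Z) P) :
    IndepFun (fun ω => (Z 0 ω, W 0 ω))
      (fun ω (j : ℕ) => ∑ i ∈ Finset.range j, (Z (i + 1) ω - c * W (i + 1) ω)) P := by
  have hmeas : ∀ i, Measurable (Sum.elim W Z i) := by
    rintro (i | i)
    exacts [hW i, hZ i]
  set m : ℕ ⊕ ℕ → MeasurableSpace Ω :=
    fun i => MeasurableSpace.comap (Sum.elim W Z i) inferInstance with hm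
  let S : Set (ℕ ⊕ ℕ) := {Sum.inl 0, Sum.inr 0}
  have h := indep_iSup_of_disjoint (fun i => (hmeas i).comap_le)
    ((iIndepFun_iff_iIndep _ (Sum.elim W Z) P).1 hind) (S := S) (T := Sᶜ)
    (Set.disjoint_compl_right_iff_subset.2 subset_rfl)
  have hle : ∀ (T : Set (ℕ ⊕ ℕ)) (i), i ∈ T →
      Measurable[⨆ i ∈ T, m i] (Sum.elim W Z i) := fun T i hi =>
    Measurable.mono (comap_measurable _) (le_iSup₂_of_le i hi le_rfl) le_rfl
  refine indep_of_indep_of_le_left (indep_of_indep_of_le_right h ?_) ?_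
  · refine Measurable.comap_le ?_
    refine @measurable_pi_lambda _ _ _ (⨆ i ∈ Sᶜ, m i) _ _ fun j => ?_
    refine @Finset.measurable_fun_sum _ _ _ _ _ _ (⨆ i ∈ Sᶜ, m i) _ _ fun i _ => ?_
    have h1 := hle Sᶜ (Sum.inr (i + 1)) (by simp [S])
    have h2 := hle Sᶜ (Sum.inl (i + 1)) (by simp [S])
    exact h1.sub (h2.const_mul c)
  · refine Measurable.comap_le ?_
    have h1 := hle S (Sum.inr 0) (by simp [S])
    have h2 := hle S (Sum.inl 0) (by simp [S])
    exact h1.prodMk h2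

/-- Condition on the first pair `(Z 0, W 0)`. The later increments are independent of it and form a
walk of the same kind, so the induction runs over all sequences `W`, `Z` in order to apply to the
shifted ones. -/
theorem measure_exists_le_eq_ruinBefore [IsProbabilityMeasure κ] [IsProbabilityMeasure ν]
    [IsProbabilityMeasure P] (n : ℕ) (u : ℝ) {W Z : ℕ → Ω → ℝ} (hW : ∀ i, Measurable (W i))
    (hZ : ∀ i, Measurable (Z i)) (lW : ∀ i, P.map (W i) = κ) (lZ : ∀ i, P.map (Z i) = ν)
    (hind : iIndepFun (Sum.elim W Z) P) :
    P {ω | ∃ j ≤ n, u < ∑ i ∈ Finset.range j, (Z i ω - c * W i ω)} = ruinBefore c κ ν n u := by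
  induction n generalizing u W Z with
  | zero =>
    rcases lt_or_ge u 0 with hu | hu
    · simp [ruinBefore, hu]
    · simp [ruinBefore, hu.not_gt]
  | succ n ih =>
    rcases lt_or_ge u 0 with hu | hu
    · rw [ruinBefore_of_neg _ hu]
      have : {ω | ∃ j ≤ n + 1, u < ∑ i ∈ Finset.range j, (Z i ω - c * W i ω)} = univ := by
        ext ω; simp only [mem_ofPred_eq, mem_univ, iff_true]
        exact ⟨0, by simp, by simpa using hu⟩
      rw [this, measure_univ]
    · set X : Ω → ℝ × ℝ := fun ω => (Z 0 ω, W 0 ω) with hX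
      set Y : Ω → ℕ → ℝ :=
        fun ω j => ∑ i ∈ Finset.range j, (Z (i + 1) ω - c * W (i + 1) ω) with hY
      have hXm : Measurable X := (hZ 0).prodMk (hW 0)
      have hYm : Measurable Y := measurable_pi_lambda _ fun j =>
        Finset.measurable_fun_sum _ fun i _ => (hZ _).sub ((hW _).const_mul c)
      let A : Set ((ℝ × ℝ) × (ℕ → ℝ)) := {q | ∃ j ≤ n, u - q.1.1 + c * q.1.2 < q.2 j}
      have hA : MeasurableSet A := by
        have : A = ⋃ j ∈ Finset.range (n + 1), {q | u - q.1.1 + c * q.1.2 < q.2 j} := by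
          ext q; simp [A]
        rw [this]
        refine Finset.measurableSet_biUnion _ fun j _ => measurableSet_lt (by fun_prop) (by fun_prop)
      have hset : {ω | ∃ j ≤ n + 1, u < ∑ i ∈ Finset.range j, (Z i ω - c * W i ω)} =
          (fun ω => (X ω, Y ω)) ⁻¹' A := by
        ext ω
        simp only [mem_ofPred_eq, mem_preimage, A, X, Y]
        constructor
        · rintro ⟨j, hj, h⟩
          rcases j with _ | j
          · simp at h; linarith
          · refine ⟨j, by omega, ?_⟩
            rw [Finset.sum_range_succ'] at h
            linarith
        · rintro ⟨j, hj, h⟩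
          refine ⟨j + 1, by omega, ?_⟩
          rw [Finset.sum_range_succ']
          linarith
      have hindX : IndepFun (Z 0) (W 0) P := by
        have := hind.indepFun (i := Sum.inr 0) (j := Sum.inl 0) (by simp)
        simpa using this
      have hmapX : P.map X = ν.prod κ := by
        rw [hX, (indepFun_iff_map_prod_eq_prod_map_map (hZ 0).aemeasurable
          (hW 0).aemeasurable).1 hindX, lZ, lW]
      have hind' : iIndepFun (Sum.elim (fun i => W (i + 1)) fun i => Z (i + 1)) P := by
        have := hind.precomp (g := Sum.map (· + 1) (· + 1))
          (Sum.map_injective.2 ⟨add_left_injective 1, add_left_injective 1⟩)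
        convert this using 1
        ext i; rcases i with i | i <;> rfl
      rw [hset, ← Measure.map_apply (hXm.prodMk hYm) hA,
        (indepFun_iff_map_prod_eq_prod_map_map hXm.aemeasurable hYm.aemeasurable).1
          (indepFun_head_tail hW hZ hind), hmapX, ruinBefore_succ n hu]
      have : IsProbabilityMeasure (P.map Y) := Measure.isProbabilityMeasure_map hYm.aemeasurable
      rw [Measure.prod_apply hA]
      have hsec : ∀ q : ℝ × ℝ, P.map Y (Prod.mk q ⁻¹' A) =
          ruinBefore c κ ν n (u - q.1 + c * q.2) := by
        intro q
        rw [Measure.map_apply hYm (measurable_prodMk_left hA),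
          ← ih (u - q.1 + c * q.2) (fun i => hW (i + 1)) (fun i => hZ (i + 1))
            (fun i => lW (i + 1)) (fun i => lZ (i + 1)) hind']
        rfl
      simp_rw [hsec]
      exact lintegral_prod _ (((ruinBefore_antitone n).measurable.comp
        (by fun_prop)).aemeasurable)

theorem measure_exists_eq_ruinLimit [IsProbabilityMeasure κ] [IsProbabilityMeasure ν]
    [IsProbabilityMeasure P] (u : ℝ) {W Z : ℕ → Ω → ℝ} (hW : ∀ i, Measurable (W i))
    (hZ : ∀ i, Measurable (Z i)) (lW : ∀ i, P.map (W i) = κ) (lZ : ∀ i, P.map (Z i) = ν)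
    (hind : iIndepFun (Sum.elim W Z) P) :
    P {ω | ∃ j, u < ∑ i ∈ Finset.range j, (Z i ω - c * W i ω)} = ruinLimit c κ ν u := by
  have : {ω | ∃ j, u < ∑ i ∈ Finset.range j, (Z i ω - c * W i ω)} =
      ⋃ n : ℕ, {ω | ∃ j ≤ n, u < ∑ i ∈ Finset.range j, (Z i ω - c * W i ω)} := by
    ext ω
    simp only [mem_ofPred_eq, mem_iUnion]
    exact ⟨fun ⟨j, h⟩ => ⟨j, j, le_rfl, h⟩, fun ⟨_, j, _, h⟩ => ⟨j, h⟩⟩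
  rw [this, Monotone.measure_iUnion]
  · simp_rw [measure_exists_le_eq_ruinBefore _ u hW hZ lW lZ hind]
    rfl
  · intro a b hab ω
    simp only [mem_ofPred_eq]
    rintro ⟨j, hj, h⟩
    exact ⟨j, hj.trans hab, h⟩

end RandomWalk

theorem ae_pos_expMeasure {r : ℝ} (hr : 0 < r) : ∀ᵐ x ∂expMeasure r, 0 < x := by
  have hprob := isProbabilityMeasure_expMeasure hr
  have h : expMeasure r (Iic 0) = 0 := by
    have := cdf_expMeasure_eq hr 0
    rw [cdf_eq_real] at this
    simpa [measureReal_eq_zero_iff] using this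
  rw [ae_iff]
  convert h using 2
  ext ω
  simp

/-! ### From the continuous-time reserve to the random walk at claim times -/

namespace RiskModel

variable {Ω : Type*} [MeasurableSpace Ω] {P : Measure Ω} {ν : Measure ℝ}

theorem ruinTime_lt_top_iff (X : RiskModel P ν) (u : ℝ) (ω : Ω) :
    X.ruinTime u ω < ∞ ↔ ∃ t : ℝ≥0, X.reserve u t ω < 0 := by
  simp [ruinTime, iInf_lt_iff]

/-- Between claims the premium only increases the reserve, so a negative reserve is already negative
at the latest counted claim. -/
theorem exists_reserve_neg_iff (X : RiskModel P ν) {u : ℝ} (hu : 0 ≤ u) {ω : Ω}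
    (hpos : ∀ i, 0 < X.W i ω) :
    (∃ t : ℝ≥0, X.reserve u t ω < 0) ↔
      ∃ j, u < ∑ i ∈ Finset.range j, (X.Z i ω - X.c * X.W i ω) := by
  have hmono : StrictMono fun n => X.claimTime n ω := by
    refine strictMono_nat_of_lt_succ fun n => ?_
    simp only [claimTime]
    rw [Finset.sum_range_succ _ (n + 1)]
    linarith [hpos (n + 1)]
  have hsum : ∀ n, ∑ i ∈ Finset.range (n + 1), (X.Z i ω - X.c * X.W i ω) =
      ∑ i ∈ Finset.range (n + 1), X.Z i ω - X.c * X.claimTime n ω := by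
    intro n
    rw [Finset.sum_sub_distrib, claimTime, Finset.mul_sum]
  constructor
  · rintro ⟨t, ht⟩
    have hct : 0 ≤ X.c * t := mul_nonneg X.c_pos.le t.2
    set A := {n : ℕ | X.claimTime n ω ≤ t} with hA
    -- `ncard` is `0` on an infinite set. If infinitely many claims occur before `t`, the reserve is
    -- therefore `u + ct ≥ 0`, and the zero case covers this too; a nonzero count forces finiteness.
    rcases hN : X.claimCount t ω with _ | N
    · rw [reserve, hN] at ht
      simp at ht
      linarith
    · rw [reserve, hN] at ht
      have hfin : A.Finite := finite_of_ncard_ne_zero (by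
        have : A.ncard = N + 1 := hN
        omega)
      -- `N + 1` distinct indices cannot all be smaller than `N`.
      obtain ⟨n, hnA, hn⟩ : ∃ n ∈ A, N ≤ n := by
        by_contra! hcon
        have h1 : A ⊆ Finset.range N := fun n hn => by simpa using hcon n hn
        have h2 := ncard_le_ncard h1 (Finset.finite_toSet _)
        rw [ncard_coe_finset, Finset.card_range] at h2
        have : A.ncard = N + 1 := hN
        omega
      have hNt : X.claimTime N ω ≤ t := (hmono.monotone hn).trans hnA
      refine ⟨N + 1, ?_⟩
      rw [hsum]
      have := mul_le_mul_of_nonneg_left hNt X.c_pos.le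
      linarith
  · rintro ⟨j, hj⟩
    rcases j with _ | n
    · simp at hj; linarith
    · have ht0 : 0 ≤ X.claimTime n ω := Finset.sum_nonneg fun i _ => (hpos i).le
      obtain ⟨t, ht⟩ : ∃ t : ℝ≥0, (t : ℝ) = X.claimTime n ω := ⟨⟨_, ht0⟩, rfl⟩
      refine ⟨t, ?_⟩
      have hset : {m : ℕ | X.claimTime m ω ≤ t} =
          Finset.range (n + 1) := by
        ext m
        simp only [mem_ofPred_eq, ht, Finset.coe_range, mem_Iio, Nat.lt_succ_iff]
        exact hmono.le_iff_le
      have hcount : X.claimCount t ω = n + 1 := by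
        rw [claimCount, hset, ncard_coe_finset, Finset.card_range]
      rw [reserve, hcount, ht]
      rw [hsum] at hj
      linarith

theorem ae_forall_pos_W (X : RiskModel P ν) : ∀ᵐ ω ∂P, ∀ i, 0 < X.W i ω :=
  ae_all_iff.2 fun i => ae_of_ae_map (X.measurable_W i).aemeasurable (by
    rw [X.law_W i]; exact ae_pos_expMeasure X.lam_pos)

theorem ruinProb_eq [IsProbabilityMeasure P] [IsProbabilityMeasure ν] (X : RiskModel P ν) {u : ℝ}
    (hu : 0 ≤ u) : X.ruinProb u = (ruinLimit X.c (expMeasure X.lam) ν u).toReal := by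
  have hprob := isProbabilityMeasure_expMeasure X.lam_pos
  rw [← measure_exists_eq_ruinLimit u X.measurable_W X.measurable_Z X.law_W X.law_Z X.indep,
    ruinProb, Measure.real]
  congr 1
  refine measure_congr ?_
  filter_upwards [X.ae_forall_pos_W] with ω hω
  exact propext ((X.ruinTime_lt_top_iff u ω).trans (X.exists_reserve_neg_iff hu hω))

end RiskModel

/-! ### The renewal equation of the ruin probability -/

/-- Layer cake formula for a law on `(0, ∞)`. -/
theorem lintegral_setLIntegral_Ioo (μ : Measure ℝ) [SFinite μ] {G : ℝ → ℝ≥0∞}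
    (hG : Measurable G) :
    ∫⁻ z, (∫⁻ x in Ioo 0 z, G x) ∂μ = ∫⁻ x in Ioi 0, G x * μ (Ioi x) := by
  have hA : MeasurableSet {p : ℝ × ℝ | 0 < p.2 ∧ p.2 < p.1} :=
    (measurableSet_lt measurable_const measurable_snd).inter
      (measurableSet_lt measurable_snd measurable_fst)
  set f : ℝ × ℝ → ℝ≥0∞ := {p : ℝ × ℝ | 0 < p.2 ∧ p.2 < p.1}.indicator fun p => G p.2 with hf
  have hfm : Measurable f := (hG.comp measurable_snd).indicator hA
  calc ∫⁻ z, (∫⁻ x in Ioo 0 z, G x) ∂μ = ∫⁻ z, (∫⁻ x, f (z, x)) ∂μ := by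
        refine lintegral_congr fun z => ?_
        rw [← lintegral_indicator measurableSet_Ioo]
        rfl
    _ = ∫⁻ x, ∫⁻ z, f (z, x) ∂μ := lintegral_lintegral_swap (f := fun z x => f (z, x)) hfm.aemeasurable
    _ = ∫⁻ x, (Ioi 0).indicator (fun x => G x * μ (Ioi x)) x := by
        refine lintegral_congr fun x => ?_
        by_cases hx : 0 < x
        · rw [indicator_of_mem (show x ∈ Ioi 0 from hx),
            ← lintegral_indicator_const measurableSet_Ioi]
          refine lintegral_congr fun z => ?_
          by_cases hz : x < z <;> simp [hf, indicator, hx, hz]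
        · rw [indicator_of_notMem (by simpa using hx)]
          simp [hf, hx]
    _ = _ := lintegral_indicator measurableSet_Ioi _

theorem setLIntegral_Ioi_zero_add (f : ℝ → ℝ≥0∞) (x : ℝ) :
    ∫⁻ s in Ioi 0, f (s + x) = ∫⁻ r in Ioi x, f r := by
  rw [← lintegral_indicator measurableSet_Ioi, ← lintegral_indicator measurableSet_Ioi,
    ← lintegral_add_right_eq_self ((Ioi x).indicator f) x]
  refine lintegral_congr fun s => ?_
  simp [indicator]

theorem setLIntegral_Ioc_neg_zero (f : ℝ → ℝ≥0∞) (z : ℝ) :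
    ∫⁻ t in Ioc (-z) 0, f t = ∫⁻ x in Ioo 0 z, f (-x) := by
  rw [setLIntegral_congr (Ioo_ae_eq_Ico (a := (0 : ℝ)) (b := z) (μ := volume)),
    ← lintegral_indicator measurableSet_Ioc, ← lintegral_indicator measurableSet_Ico,
    ← lintegral_neg_eq_self]
  refine lintegral_congr fun s => ?_
  simp only [indicator, mem_Ioc, mem_Ico, neg_lt_neg_iff, Left.neg_nonpos_iff, and_comm]

/-- Split the integral over `(0, ∞)` at the random point `x`; the part below `x` averages to the
tail-weighted integral by the layer cake formula. -/
theorem lintegral_setLIntegral_Ioi_add (μ : Measure ℝ) [IsProbabilityMeasure μ]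
    (hμ : ∀ᵐ x ∂μ, 0 < x) {G : ℝ → ℝ≥0∞} (hG : Measurable G) :
    ∫⁻ x, (∫⁻ r in Ioi x, G r) ∂μ + ∫⁻ r in Ioi 0, G r * μ (Ioi r) = ∫⁻ r in Ioi 0, G r := by
  have hm : Measurable fun x : ℝ => ∫⁻ r in Ioi x, G r := by
    refine Antitone.measurable fun x y hxy => ?_
    exact lintegral_mono_set (Ioi_subset_Ioi hxy)
  rw [← lintegral_setLIntegral_Ioo μ hG, ← lintegral_add_left hm]
  calc _ = ∫⁻ _, (∫⁻ r in Ioi 0, G r) ∂μ := by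
        refine lintegral_congr_ae ?_
        filter_upwards [hμ] with x hx
        rw [setLIntegral_congr (Ioo_ae_eq_Ioc (a := (0 : ℝ)) (b := x) (μ := volume)), add_comm,
          ← lintegral_union measurableSet_Ioi Ioc_disjoint_Ioi_same, Ioc_union_Ioi_eq_Ioi hx.le]
    _ = _ := by simp

theorem expMeasure_Ioi {r : ℝ} (hr : 0 < r) {x : ℝ} (hx : 0 ≤ x) :
    expMeasure r (Ioi x) = ENNReal.ofReal (Real.exp (-(r * x))) := by
  have hprob := isProbabilityMeasure_expMeasure hr
  have h := cdf_expMeasure_eq hr x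
  rw [cdf_eq_real, if_pos hx] at h
  rw [← compl_Iic, ← ofReal_measureReal, probReal_compl_eq_one_sub measurableSet_Iic, h]
  congr 1; ring

theorem lintegral_expMeasure {r : ℝ} {f : ℝ → ℝ≥0∞} (hf : Measurable f) :
    ∫⁻ x, f x ∂expMeasure r =
      ∫⁻ x in Ioi 0, ENNReal.ofReal (r * Real.exp (-(r * x))) * f x := by
  have h : expMeasure r = volume.withDensity (exponentialPDF r) := rfl
  rw [h, lintegral_withDensity_eq_lintegral_mul _
    (show Measurable (exponentialPDF r) from (measurable_exponentialPDFReal r).ennreal_ofReal) hf,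
    setLIntegral_congr (Ioi_ae_eq_Ici (a := (0 : ℝ)) (μ := volume)),
    ← lintegral_indicator measurableSet_Ici]
  refine lintegral_congr fun x => ?_
  by_cases hx : 0 ≤ x <;> simp [exponentialPDF_eq, indicator, hx]

theorem lintegral_mul_left_eq {c : ℝ} (hc : 0 < c) {f : ℝ → ℝ≥0∞} (hf : Measurable f) :
    ENNReal.ofReal c * ∫⁻ x, f (c * x) = ∫⁻ x, f x := by
  conv_rhs => rw [← Real.smul_map_volume_mul_left hc.ne']
  rw [lintegral_smul_measure, lintegral_map hf (measurable_const_mul c), abs_of_pos hc, smul_eq_mul]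

theorem map_mul_left_expMeasure {c r : ℝ} (hc : 0 < c) :
    (expMeasure r).map (c * ·) = expMeasure (r / c) := by
  refine Measure.ext_of_lintegral _ fun f hf => ?_
  rw [lintegral_map hf (measurable_const_mul c), lintegral_expMeasure (by fun_prop),
    lintegral_expMeasure hf, ← lintegral_indicator measurableSet_Ioi,
    ← lintegral_indicator measurableSet_Ioi, ← lintegral_mul_left_eq hc
      (f := (Ioi 0).indicator fun x => ENNReal.ofReal (r / c * Real.exp (-(r / c * x))) * f x)
      (Measurable.indicator (by fun_prop) measurableSet_Ioi),
    ← lintegral_const_mul' _ _ ENNReal.ofReal_ne_top]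
  refine lintegral_congr fun x => ?_
  by_cases hx : 0 < x
  · rw [indicator_of_mem (show x ∈ Ioi 0 from hx),
      indicator_of_mem (show c * x ∈ Ioi 0 from mul_pos hc hx), ← mul_assoc,
      ← ENNReal.ofReal_mul hc.le]
    congr 2
    have : r / c * (c * x) = r * x := by field_simp
    rw [this]
    field_simp
  · rw [indicator_of_notMem (by simpa using hx), indicator_of_notMem, mul_zero]
    all_goals simpa [hc] using hx

/-- The renewal equation of the ruin probability. -/
theorem renewal_of_claim_equation {ν : Measure ℝ} [IsProbabilityMeasure ν]
    (hν : ∀ᵐ z ∂ν, 0 < z) {c r : ℝ} (hc : 0 < c) (hr : 0 < r) {Ψ : ℝ → ℝ≥0∞} (hΨ : Measurable Ψ)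
    (hfin : ∫⁻ x in Ioi 0, Ψ x ≠ ∞)
    (heq : ∀ u, 0 ≤ u → Ψ u = ∫⁻ z, ∫⁻ w, Ψ (u - z + c * w) ∂expMeasure r ∂ν)
    {u : ℝ} (hu : 0 ≤ u) :
    Ψ u = ENNReal.ofReal (r / c) * ∫⁻ x in Ioi 0, Ψ (u - x) * ν (Ioi x) := by
  have hprob := isProbabilityMeasure_expMeasure hr
  have ha : 0 < r / c := div_pos hr hc
  have hprob' := isProbabilityMeasure_expMeasure ha
  -- With `a = r/c`, the claim equation is the resolvent form of `Ψ' = aΨ - aD`. It is integrated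
  -- over `(u, ∞)`, which requires no differentiability of `Ψ`.
  set D : ℝ → ℝ≥0∞ := fun s => ∫⁻ z, Ψ (s - z) ∂ν with hD
  have hDm : Measurable D :=
    Measurable.lintegral_prod_right' (f := fun p : ℝ × ℝ => Ψ (p.1 - p.2)) (by fun_prop)
  have hΨD : ∀ v, 0 ≤ v → Ψ v = ∫⁻ x, D (v + x) ∂expMeasure (r / c) := by
    intro v hv
    rw [heq v hv, ← map_mul_left_expMeasure hc, lintegral_map (by fun_prop) (by fun_prop),
      lintegral_lintegral_swap (by fun_prop)]
    refine lintegral_congr fun w => lintegral_congr fun z => ?_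
    congr 1; ring
  have h1 : ∫⁻ s in Ioi 0, Ψ (u + s) =
      ∫⁻ x, (∫⁻ r in Ioi x, D (u + r)) ∂expMeasure (r / c) := by
    calc _ = ∫⁻ s in Ioi 0, ∫⁻ x, D (u + (s + x)) ∂expMeasure (r / c) := by
          refine setLIntegral_congr_fun measurableSet_Ioi fun s hs => ?_
          simp only [mem_Ioi] at hs
          rw [hΨD (u + s) (by positivity)]
          simp only [add_assoc]
      _ = ∫⁻ x, (∫⁻ s in Ioi 0, D (u + (s + x))) ∂expMeasure (r / c) :=
          lintegral_lintegral_swap (by fun_prop)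
      _ = _ := lintegral_congr fun x => setLIntegral_Ioi_zero_add (fun r => D (u + r)) x
  have h2 : ∫⁻ s in Ioi 0, D (u + s) * expMeasure (r / c) (Ioi s) =
      ENNReal.ofReal (c / r) * Ψ u := by
    rw [hΨD u hu, lintegral_expMeasure (by fun_prop), ← lintegral_const_mul' _ _
      ENNReal.ofReal_ne_top]
    refine setLIntegral_congr_fun measurableSet_Ioi fun s hs => ?_
    rw [expMeasure_Ioi ha (le_of_lt hs), ← mul_assoc, ← ENNReal.ofReal_mul (by positivity), mul_comm]
    congr 2
    field_simp
  -- Shifting by `z` extends the domain of integration to the left by `(-z, 0]`; averaged over `z`,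
  -- this extra piece is the renewal integral.
  have h3 : ∫⁻ s in Ioi 0, D (u + s) =
      (∫⁻ s in Ioi 0, Ψ (u + s)) + ∫⁻ x in Ioi 0, Ψ (u - x) * ν (Ioi x) := by
    calc _ = ∫⁻ z, (∫⁻ s in Ioi 0, Ψ (u + (s + -z))) ∂ν := by
          rw [hD, lintegral_lintegral_swap (by fun_prop)]
          refine lintegral_congr fun z => lintegral_congr fun s => ?_
          congr 1; ring
      _ = ∫⁻ z, ((∫⁻ s in Ioi 0, Ψ (u + s)) + ∫⁻ x in Ioo 0 z, Ψ (u - x)) ∂ν := by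
          refine lintegral_congr_ae ?_
          filter_upwards [hν] with z hz
          rw [setLIntegral_Ioi_zero_add (fun r => Ψ (u + r)) (-z),
            ← Ioc_union_Ioi_eq_Ioi (show -z ≤ 0 by linarith),
            lintegral_union measurableSet_Ioi Ioc_disjoint_Ioi_same,
            setLIntegral_Ioc_neg_zero, add_comm]
          simp only [← sub_eq_add_neg]
      _ = _ := by
          rw [lintegral_add_left measurable_const,
            lintegral_setLIntegral_Ioo ν (by fun_prop : Measurable fun x => Ψ (u - x))]
          simp
  have h4 := lintegral_setLIntegral_Ioi_add (expMeasure (r / c)) (ae_pos_expMeasure ha)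
    (by fun_prop : Measurable fun s => D (u + s))
  rw [h2, h3, ← h1] at h4
  -- Finiteness allows this term to be cancelled from both sides of `h4`, which leaves the renewal
  -- equation.
  have hfin' : ∫⁻ s in Ioi 0, Ψ (u + s) ≠ ∞ := by
    refine ne_top_of_le_ne_top hfin ?_
    simp_rw [add_comm u]
    rw [setLIntegral_Ioi_zero_add]
    exact lintegral_mono_set (Ioi_subset_Ioi hu)
  rw [ENNReal.add_right_inj hfin'] at h4
  rw [← h4, ← mul_assoc, ← ENNReal.ofReal_mul ha.le]
  have : r / c * (c / r) = 1 := by field_simp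
  simp [this]

/-! ### The claim law and its exponentially tilted integrated tail -/

section ClaimLaw

variable {ν : Measure ℝ}

theorem IsClaimLaw.ae_pos (hν : IsClaimLaw ν) : ∀ᵐ z ∂ν, 0 < z := by
  rw [ae_iff]
  convert hν.positive using 2
  ext z
  simp

theorem claimTail_eq_real [IsProbabilityMeasure ν] (x : ℝ) : claimTail ν x = ν.real (Ioi x) := by
  rw [claimTail, cdf_eq_real, ← compl_Iic, probReal_compl_eq_one_sub measurableSet_Iic]

theorem IsClaimLaw.claimTail_pos (hν : IsClaimLaw ν) (x : ℝ) : 0 < claimTail ν x :=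
  sub_pos.2 (hν.unbounded x)

theorem measurable_claimTail : Measurable (claimTail ν) :=
  measurable_const.sub (monotone_cdf ν).measurable

/-- Both integrands are nonnegative, so the layer cake formula for `lintegral` transfers without an
integrability assumption: if the common value is infinite, both sides are `0`. -/
theorem IsClaimLaw.integral_intervalIntegral (hν : IsClaimLaw ν) {g : ℝ → ℝ} (hg : Continuous g)
    (hg0 : ∀ x, 0 ≤ x → 0 ≤ g x) :
    ∫ z, (∫ t in (0 : ℝ)..z, g t) ∂ν = ∫ x in Ioi 0, claimTail ν x * g x := by
  have := hν.isProbabilityMeasure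
  rw [integral_eq_lintegral_of_nonneg_ae, integral_eq_lintegral_of_nonneg_ae,
    lintegral_comp_eq_lintegral_meas_lt_mul ν (f := fun z => z)
      (hν.ae_pos.mono fun z hz => hz.le) aemeasurable_id
      (fun t _ => hg.intervalIntegrable _ _)
      ((ae_restrict_mem measurableSet_Ioi).mono fun t ht => hg0 t (le_of_lt ht))]
  · congr 1
    refine lintegral_congr fun x => ?_
    rw [ENNReal.ofReal_mul (hν.claimTail_pos x).le, claimTail_eq_real, ofReal_measureReal]
    rfl
  · exact (ae_restrict_mem measurableSet_Ioi).mono fun t ht =>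
      mul_nonneg (hν.claimTail_pos t).le (hg0 t (le_of_lt ht))
  · exact (measurable_claimTail.mul hg.measurable).aestronglyMeasurable
  · filter_upwards [hν.ae_pos] with z hz
    exact intervalIntegral.integral_nonneg hz.le fun t ht => hg0 t ht.1
  · exact (intervalIntegral.continuous_primitive (fun a b => hg.intervalIntegrable a b) 0).aestronglyMeasurable

theorem IsClaimLaw.claimMoment_one_eq (hν : IsClaimLaw ν) :
    claimMoment ν 1 = ∫ x in Ioi 0, claimTail ν x := by
  have h := hν.integral_intervalIntegral (continuous_const (y := (1 : ℝ))) fun _ _ => zero_le_one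
  simpa [claimMoment] using h

theorem IsClaimLaw.claimMoment_two_eq (hν : IsClaimLaw ν) :
    claimMoment ν 2 = 2 * ∫ x in Ioi 0, x * claimTail ν x := by
  have h := hν.integral_intervalIntegral (g := fun t => 2 * t) (by fun_prop)
    fun x hx => by positivity
  have h' : ∀ z : ℝ, ∫ t in (0 : ℝ)..z, 2 * t = z ^ 2 := fun z => by
    rw [intervalIntegral.integral_const_mul, integral_id]; ring
  simp only [h'] at h
  rw [claimMoment, h, ← integral_const_mul]
  congr 1; ext x; ring

/-- The exponentially tilted integrated tail distribution, with density
`exp (R x) f_I(x) / (1 + θ)` on `(0, ∞)`. -/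
noncomputable def tiltedLaw (ν : Measure ℝ) (θ R : ℝ) : Measure ℝ :=
  (volume.restrict (Ioi 0)).withDensity fun x =>
    ENNReal.ofReal (Real.exp (R * x) * (integratedTailDensity ν x / (1 + θ)))

theorem measurable_tiltedDensity (θ R : ℝ) : Measurable fun x =>
    Real.exp (R * x) * (integratedTailDensity ν x / (1 + θ)) := by
  have := measurable_claimTail (ν := ν)
  unfold integratedTailDensity
  fun_prop

namespace IsAdjustmentCoefficient

variable {θ R : ℝ}

/-- If `m₁` were `0`, also as the default value for an infinite mean, division by zero would make
the density vanish, and its integral could not be `1`. -/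
theorem claimMoment_one_pos (h : IsAdjustmentCoefficient ν θ R) (hν : IsClaimLaw ν) :
    0 < claimMoment ν 1 := by
  refine lt_of_le_of_ne ?_ fun h0 => ?_
  · exact integral_nonneg_of_ae (hν.ae_pos.mono fun z hz => by
      simpa using hz.le)
  · have := h.2
    simp [integratedTailDensity, ← h0] at this

theorem density_pos (h : IsAdjustmentCoefficient ν θ R) (hν : IsClaimLaw ν) (hθ : 0 < θ) (x : ℝ) :
    0 < integratedTailDensity ν x / (1 + θ) :=
  div_pos (div_pos (hν.claimTail_pos x) (h.claimMoment_one_pos hν)) (by linarith)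

theorem tiltedDensity_pos (h : IsAdjustmentCoefficient ν θ R) (hν : IsClaimLaw ν) (hθ : 0 < θ)
    (x : ℝ) : 0 < Real.exp (R * x) * (integratedTailDensity ν x / (1 + θ)) :=
  mul_pos (Real.exp_pos _) (h.density_pos hν hθ x)

/-- A Bochner integral equal to `1` is not the default value `0` of a divergent one. -/
theorem integrableOn_tiltedDensity (h : IsAdjustmentCoefficient ν θ R) :
    IntegrableOn (fun x => Real.exp (R * x) * (integratedTailDensity ν x / (1 + θ))) (Ioi 0) :=
  Integrable.of_integral_ne_zero (by rw [h.2]; exact one_ne_zero)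

theorem isProbabilityMeasure_tiltedLaw (h : IsAdjustmentCoefficient ν θ R) (hν : IsClaimLaw ν)
    (hθ : 0 < θ) : IsProbabilityMeasure (tiltedLaw ν θ R) := by
  constructor
  rw [tiltedLaw, withDensity_apply _ MeasurableSet.univ, Measure.restrict_univ,
    ← ofReal_integral_eq_lintegral_ofReal h.integrableOn_tiltedDensity
      (Filter.Eventually.of_forall fun x => (h.tiltedDensity_pos hν hθ x).le), h.2,
    ENNReal.ofReal_one]

theorem integral_tiltedLaw (h : IsAdjustmentCoefficient ν θ R) (hν : IsClaimLaw ν)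
    (hθ : 0 < θ) (f : ℝ → ℝ) : ∫ x, f x ∂tiltedLaw ν θ R =
      ∫ x in Ioi 0, Real.exp (R * x) * (integratedTailDensity ν x / (1 + θ)) * f x := by
  rw [tiltedLaw, integral_withDensity_eq_integral_toReal_smul
    (measurable_tiltedDensity θ R).ennreal_ofReal (by simp)]
  refine integral_congr_ae (Filter.Eventually.of_forall fun x => ?_)
  simp only [ENNReal.toReal_ofReal (h.tiltedDensity_pos hν hθ x).le, smul_eq_mul]

theorem integrable_tiltedLaw_iff (h : IsAdjustmentCoefficient ν θ R) (hν : IsClaimLaw ν)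
    (hθ : 0 < θ) (f : ℝ → ℝ) : Integrable f (tiltedLaw ν θ R) ↔
      IntegrableOn (fun x => Real.exp (R * x) * (integratedTailDensity ν x / (1 + θ)) * f x)
        (Ioi 0) := by
  rw [tiltedLaw, integrable_withDensity_iff_integrable_smul'
    (measurable_tiltedDensity θ R).ennreal_ofReal (by simp), IntegrableOn]
  refine integrable_congr (Filter.Eventually.of_forall fun x => ?_)
  simp only [ENNReal.toReal_ofReal (h.tiltedDensity_pos hν hθ x).le, smul_eq_mul]

theorem expMoment_eq (h : IsAdjustmentCoefficient ν θ R) (hν : IsClaimLaw ν)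
    (hθ : 0 < θ) (j : ℕ) : expMoment ν θ R j = ∫ x, x ^ j ∂tiltedLaw ν θ R := by
  rw [h.integral_tiltedLaw hν hθ, expMoment]
  congr 1; ext x; ring

theorem hasExpMoment_iff (h : IsAdjustmentCoefficient ν θ R) (hν : IsClaimLaw ν)
    (hθ : 0 < θ) (j : ℕ) :
    HasExpMoment ν θ R j ↔ Integrable (fun x => x ^ j) (tiltedLaw ν θ R) := by
  rw [h.integrable_tiltedLaw_iff hν hθ, HasExpMoment]
  refine integrable_congr (Filter.Eventually.of_forall fun x => ?_)
  simp only
  ring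

theorem ae_pos_tiltedLaw : ∀ᵐ x ∂tiltedLaw ν θ R, 0 < x :=
  (withDensity_absolutelyContinuous _ _).ae_le (ae_restrict_mem measurableSet_Ioi)

theorem real_tiltedLaw_Iic_lt_one (h : IsAdjustmentCoefficient ν θ R) (hν : IsClaimLaw ν)
    (hθ : 0 < θ) (x : ℝ) : (tiltedLaw ν θ R).real (Iic x) < 1 := by
  have hp := h.isProbabilityMeasure_tiltedLaw hν hθ
  have h0 : tiltedLaw ν θ R (Ioi x) ≠ 0 := by
    intro h0
    rw [tiltedLaw, withDensity_apply_eq_zero (measurable_tiltedDensity θ R).ennreal_ofReal,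
      Measure.restrict_apply' measurableSet_Ioi] at h0
    have hsub : Ioi (max x 0) ⊆
        {y | ENNReal.ofReal (Real.exp (R * y) * (integratedTailDensity ν y / (1 + θ))) ≠ 0} ∩
          Ioi x ∩ Ioi 0 := fun y hy => by
      obtain ⟨h1, h2⟩ := max_lt_iff.1 (mem_Ioi.1 hy)
      exact ⟨⟨(ENNReal.ofReal_pos.2 (h.tiltedDensity_pos hν hθ y)).ne', h1⟩, h2⟩
    have := measure_mono_null hsub h0
    simp at this
  have h1 : 0 < (tiltedLaw ν θ R).real (Ioi x) :=
    ENNReal.toReal_pos h0 (measure_ne_top _ _)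
  have h2 := probReal_add_probReal_compl (μ := tiltedLaw ν θ R) (measurableSet_Iic (a := x))
  rw [compl_Iic] at h2
  linarith

/-- The factor `exp(-Rx)` undoes the tilt; this is how the ordinary moments `m₁` and `m₂` enter the
estimates. -/
theorem integral_tiltedLaw_exp_neg_mul (h : IsAdjustmentCoefficient ν θ R) (hν : IsClaimLaw ν)
    (hθ : 0 < θ) (f : ℝ → ℝ) : ∫ x, Real.exp (-(R * x)) * f x ∂tiltedLaw ν θ R =
      1 / (claimMoment ν 1 * (1 + θ)) * ∫ x in Ioi 0, f x * claimTail ν x := by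
  rw [h.integral_tiltedLaw hν hθ, ← integral_const_mul]
  congr 1; ext x
  have := Real.exp_pos (R * x)
  have := h.claimMoment_one_pos hν
  rw [Real.exp_neg, integratedTailDensity]
  field_simp

/-- Write `exp(Rz) = 1 + ∫₀^z R exp(Rt) dt` and apply the layer cake formula; the equation defining
`R` evaluates the remaining integral. -/
theorem lintegral_exp_claim (h : IsAdjustmentCoefficient ν θ R) (hν : IsClaimLaw ν) (hθ : 0 < θ) :
    ∫⁻ z, ENNReal.ofReal (Real.exp (R * z)) ∂ν =
      ENNReal.ofReal (1 + R * (claimMoment ν 1 * (1 + θ))) := by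
  have := hν.isProbabilityMeasure
  have hm := h.claimMoment_one_pos hν
  have hR := h.1
  have hint : ∀ z : ℝ, ∫ t in (0 : ℝ)..z, R * Real.exp (R * t) = Real.exp (R * z) - 1 := by
    intro z
    have hd : ∀ t ∈ uIcc 0 z, HasDerivAt (fun t => Real.exp (R * t)) (R * Real.exp (R * t)) t := by
      intro t _
      have := ((hasDerivAt_id t).const_mul R).exp
      simpa [mul_comm] using this
    rw [intervalIntegral.integral_eq_sub_of_hasDerivAt hd
      (Continuous.intervalIntegrable (by fun_prop) _ _)]
    simp
  have h1 := lintegral_comp_eq_lintegral_meas_lt_mul ν (f := fun z => z)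
      (g := fun t => R * Real.exp (R * t)) (hν.ae_pos.mono fun z hz => hz.le) aemeasurable_id
      (fun t _ => Continuous.intervalIntegrable (by fun_prop) _ _)
      (Filter.Eventually.of_forall fun t => by positivity)
  simp only [hint] at h1
  have h2 : ∫⁻ t in Ioi 0, ν {a | t < a} * ENNReal.ofReal (R * Real.exp (R * t)) =
      ENNReal.ofReal (R * (claimMoment ν 1 * (1 + θ))) := by
    have h3 : (fun t => R * (claimMoment ν 1 * (1 + θ)) *
        (Real.exp (R * t) * (integratedTailDensity ν t / (1 + θ)))) =
        fun t => claimTail ν t * (R * Real.exp (R * t)) := by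
      ext t
      rw [integratedTailDensity]
      field_simp
    have h4 : ∫ t in Ioi 0, claimTail ν t * (R * Real.exp (R * t)) =
        R * (claimMoment ν 1 * (1 + θ)) := by
      rw [← h3, integral_const_mul, h.2, mul_one]
    rw [← h4, ofReal_integral_eq_lintegral_ofReal]
    · refine lintegral_congr fun t => ?_
      rw [ENNReal.ofReal_mul (hν.claimTail_pos t).le, claimTail_eq_real, ofReal_measureReal]
      rfl
    · rw [← h3]
      exact h.integrableOn_tiltedDensity.const_mul _
    · exact Filter.Eventually.of_forall fun t => by
        have := hν.claimTail_pos t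
        simp only [Pi.zero_apply]
        positivity
  calc _ = ∫⁻ z, (1 + ENNReal.ofReal (Real.exp (R * z) - 1)) ∂ν := by
        refine lintegral_congr_ae ?_
        filter_upwards [hν.ae_pos] with z hz
        have : 1 ≤ Real.exp (R * z) := Real.one_le_exp (by positivity)
        rw [← ENNReal.ofReal_one, ← ENNReal.ofReal_add zero_le_one (by linarith)]
        congr 1; ring
    _ = _ := by
        rw [lintegral_add_left measurable_const, h1, h2, ENNReal.ofReal_add zero_le_one
          (by positivity)]
        simp

end IsAdjustmentCoefficient

theorem lintegral_exp_neg_expMeasure {r s : ℝ} (hr : 0 < r) (hs : 0 ≤ s) :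
    ∫⁻ w, ENNReal.ofReal (Real.exp (-(s * w))) ∂expMeasure r = ENNReal.ofReal (r / (r + s)) := by
  have hrs : 0 < r + s := by linarith
  have hp := isProbabilityMeasure_expMeasure hrs
  have h1 := lintegral_expMeasure (r := r + s) (f := fun _ => 1) measurable_const
  rw [lintegral_const, measure_univ, mul_one] at h1
  rw [lintegral_expMeasure (by fun_prop), ← mul_one (ENNReal.ofReal (r / (r + s))), h1,
    ← lintegral_const_mul' _ _ ENNReal.ofReal_ne_top]
  refine lintegral_congr fun x => ?_
  rw [mul_one, ← ENNReal.ofReal_mul (by positivity), ← ENNReal.ofReal_mul (by positivity)]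
  congr 1
  rw [mul_assoc, ← Real.exp_add]
  have : -(r * x) + -(s * x) = -((r + s) * x) := by ring
  rw [this]
  field_simp

end ClaimLaw

/-! ### Two-sided exponential bounds for the ruin probability -/

namespace RiskModel

variable {Ω : Type*} [MeasurableSpace Ω] {P : Measure Ω} {ν : Measure ℝ} {R : ℝ}

theorem c_eq (X : RiskModel P ν) (hm : 0 < claimMoment ν 1) :
    X.c = X.lam * (claimMoment ν 1 * (1 + X.safetyLoading)) := by
  have := X.lam_pos
  rw [safetyLoading]
  field_simp
  ring

/-- The claim factor is `1 + R m₁(1+θ)` and the waiting-time factor is `λ/(λ + Rc)`; they are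
inverse to each other because `c = λ m₁(1+θ)`. -/
theorem lintegral_exp_increment (X : RiskModel P ν) (hν : IsClaimLaw ν)
    (hθ : 0 < X.safetyLoading) (h : IsAdjustmentCoefficient ν X.safetyLoading R) :
    ∫⁻ z, ∫⁻ w, ENNReal.ofReal (Real.exp (R * (z - X.c * w))) ∂expMeasure X.lam ∂ν = 1 := by
  have hlam := X.lam_pos
  have hc := X.c_pos
  have hR := h.1
  have hm := h.claimMoment_one_pos hν
  calc _ = ∫⁻ z, ENNReal.ofReal (Real.exp (R * z)) *
        ENNReal.ofReal (X.lam / (X.lam + R * X.c)) ∂ν := by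
        refine lintegral_congr fun z => ?_
        rw [← lintegral_exp_neg_expMeasure hlam (by positivity : 0 ≤ R * X.c),
          ← lintegral_const_mul' _ _ ENNReal.ofReal_ne_top]
        refine lintegral_congr fun w => ?_
        rw [← ENNReal.ofReal_mul (by positivity), ← Real.exp_add]
        ring_nf
    _ = 1 := by
        rw [lintegral_mul_const' _ _ ENNReal.ofReal_ne_top, h.lintegral_exp_claim hν hθ,
          ← ENNReal.ofReal_mul (by positivity), ← ENNReal.ofReal_one]
        congr 1
        have hc' := X.c_eq hm
        have : X.lam + R * X.c = X.lam * (1 + R * (claimMoment ν 1 * (1 + X.safetyLoading))) := by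
          rw [hc']; ring
        rw [this]
        field_simp

/-- The ruin probability lies between two multiples of `exp (-R u)`. -/
theorem ruinProb_bounds [IsProbabilityMeasure P] (X : RiskModel P ν) (hν : IsClaimLaw ν)
    (hθ : 0 < X.safetyLoading) (h : IsAdjustmentCoefficient ν X.safetyLoading R)
    (h2 : HasExpMoment ν X.safetyLoading R 2) (hm : 0 < expMoment ν X.safetyLoading R 1)
    {u : ℝ} (hu : 0 ≤ u) :
    Real.exp (-(R * (5 * expMoment ν X.safetyLoading R 2 / expMoment ν X.safetyLoading R 1))) *
        Real.exp (-R * u) ≤ X.ruinProb u ∧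
      X.ruinProb u ≤ Real.exp (-R * u) := by
  have hpν := hν.isProbabilityMeasure
  have hpW := isProbabilityMeasure_expMeasure X.lam_pos
  have hpγ := h.isProbabilityMeasure_tiltedLaw hν hθ
  have hm1 := h.claimMoment_one_pos hν
  set Ψ := ruinLimit X.c (expMeasure X.lam) ν with hΨ
  have hΨm : Measurable Ψ := ruinLimit_antitone.measurable
  have hΨ1 : ∀ x, Ψ x ≤ 1 := ruinLimit_le_one
  have hΨfin : ∀ x, Ψ x ≠ ∞ := fun x => ne_top_of_le_ne_top ENNReal.one_ne_top (hΨ1 x)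
  have hΨexp : ∀ x, Ψ x ≤ ENNReal.ofReal (Real.exp (-R * x)) :=
    ruinLimit_le_exp (X.lintegral_exp_increment hν hθ h).le h.1.le
  have hΨexp' : ∀ x, (Ψ x).toReal ≤ Real.exp (-R * x) := fun x =>
    ENNReal.toReal_le_of_le_ofReal (Real.exp_nonneg _) (hΨexp x)
  have hint : ∫⁻ x in Ioi 0, Ψ x ≠ ∞ := by
    refine ne_top_of_le_ne_top ?_ (lintegral_mono hΨexp)
    rw [← ofReal_integral_eq_lintegral_ofReal (integrableOn_exp_mul_Ioi (by linarith [h.1]) 0)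
      (Filter.Eventually.of_forall fun x => Real.exp_nonneg _)]
    exact ENNReal.ofReal_ne_top
  rw [X.ruinProb_eq hu, ← hΨ]
  refine ⟨?_, hΨexp' u⟩
  -- Split `exp(Rv) = exp(Ry) exp(R(v - y))` in the renewal equation; the first factor and `λ/c =
  -- 1/(m₁(1+θ))` complete the density of the tilted law.
  have hren : ∀ v, 0 ≤ v → Real.exp (R * v) * (Ψ v).toReal =
      ∫ y, Real.exp (R * (v - y)) * (Ψ (v - y)).toReal ∂tiltedLaw ν X.safetyLoading R := by
    intro v hv
    have h1 := renewal_of_claim_equation hν.ae_pos X.c_pos X.lam_pos hΨm hint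
      (fun u hu => ruinLimit_eq_lintegral hu) hv
    rw [h1, h.integral_tiltedLaw hν hθ, ENNReal.toReal_mul, ENNReal.toReal_ofReal
      (div_nonneg X.lam_pos.le X.c_pos.le), ← integral_toReal, ← mul_assoc,
      ← integral_const_mul]
    · congr 1; ext x
      have hc := X.c_eq hm1
      have hθ' : 0 < 1 + X.safetyLoading := by linarith
      have hlam := X.lam_pos
      have e : X.lam / X.c = 1 / (claimMoment ν 1 * (1 + X.safetyLoading)) := by
        rw [hc]; field_simp
      have e' : Real.exp (R * v) = Real.exp (R * x) * Real.exp (R * (v - x)) := by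
        rw [← Real.exp_add]; ring_nf
      rw [ENNReal.toReal_mul, e, e', integratedTailDensity, claimTail_eq_real]
      simp only [Measure.real]
      field_simp
    · have : Measurable fun x => ν (Ioi x) :=
        (Antitone.measurable fun x y hxy => measure_mono (Ioi_subset_Ioi hxy))
      exact (Measurable.mul (hΨm.comp (by fun_prop)) this).aemeasurable
    · exact Filter.Eventually.of_forall fun x =>
        ENNReal.mul_lt_top (hΨfin _).lt_top (measure_lt_top _ _)
  have key := exp_neg_le_of_renewal (γ := tiltedLaw ν X.safetyLoading R)
    (Φ := fun x => Real.exp (R * x) * (Ψ x).toReal)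
    IsAdjustmentCoefficient.ae_pos_tiltedLaw
    (by simpa [h.expMoment_eq hν hθ] using hm) ((h.hasExpMoment_iff hν hθ 2).1 h2)
    (h.real_tiltedLaw_Iic_lt_one hν hθ) h.1.le
    (by fun_prop) (fun x hx => by simp [hΨ, ruinLimit_of_neg hx])
    (fun x => by positivity) (fun x => ?_) hren hu
  · rw [h.expMoment_eq hν hθ 2, h.expMoment_eq hν hθ 1]
    simp only [pow_one]
    calc _ ≤ Real.exp (R * u) * (Ψ u).toReal * Real.exp (-R * u) := by gcongr
      _ = (Ψ u).toReal := by
        rw [mul_right_comm, ← Real.exp_add]; simp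
  · calc _ ≤ Real.exp (R * x) * Real.exp (-R * x) := by gcongr; exact hΨexp' x
      _ = 1 := by rw [← Real.exp_add]; simp

end RiskModel

/-! ### Bounds for the adjustment coefficient and the Cramér–Lundberg constant -/

theorem integral_pos_of_ae_pos {γ : Measure ℝ} [IsProbabilityMeasure γ] {f : ℝ → ℝ}
    (hf : Integrable f γ) (hpos : ∀ᵐ x ∂γ, 0 < f x) : 0 < ∫ x, f x ∂γ := by
  have h0 : 0 ≤ᵐ[γ] f := hpos.mono fun x hx => hx.le
  refine lt_of_le_of_ne (integral_nonneg_of_ae h0) fun h => ?_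
  have := (integral_eq_zero_iff_of_nonneg_ae h0 hf).1 h.symm
  obtain ⟨x, h1, h2⟩ := (hpos.and this).exists
  simp [h2] at h1

/-- `exp(-t) ≤ 1/(1+t)`, and `(1+t)(1 - t + t²) = 1 + t³ ≥ 1`. -/
theorem exp_neg_le_one_sub_add_sq {t : ℝ} (ht : 0 ≤ t) : Real.exp (-t) ≤ 1 - t + t ^ 2 := by
  have h1 := Real.add_one_le_exp t
  rw [Real.exp_neg]
  refine inv_le_of_inv_le₀ (by nlinarith [sq_nonneg (t - 1)]) (le_trans ?_ h1)
  rw [inv_le_iff_one_le_mul₀ (by nlinarith [sq_nonneg (t - 1)])]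
  nlinarith [pow_nonneg ht 3]

namespace IsAdjustmentCoefficient

variable {ν : Measure ℝ} {θ R : ℝ} {k : ℕ}

theorem sq_le_one_add_pow {x : ℝ} (hx : 0 ≤ x) (hk : 2 ≤ k) : x ^ 2 ≤ 1 + x ^ k := by
  rcases le_total x 1 with h | h
  · have := pow_le_one₀ (n := 2) hx h
    have := pow_nonneg hx k
    linarith
  · have := pow_le_pow_right₀ h hk
    linarith

theorem hasExpMoment_two (h : IsAdjustmentCoefficient ν θ R) (hν : IsClaimLaw ν) (hθ : 0 < θ)
    (hk : 2 ≤ k) (hM : HasExpMoment ν θ R k) : HasExpMoment ν θ R 2 := by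
  have := h.isProbabilityMeasure_tiltedLaw hν hθ
  rw [h.hasExpMoment_iff hν hθ] at hM ⊢
  refine ((integrable_const (1 : ℝ)).add hM).mono' (by fun_prop) ?_
  filter_upwards [ae_pos_tiltedLaw] with x hx
  simp only [Real.norm_eq_abs, Pi.add_apply]
  rw [abs_of_nonneg (sq_nonneg x)]
  exact sq_le_one_add_pow hx.le hk

theorem expMoment_two_le (h : IsAdjustmentCoefficient ν θ R) (hν : IsClaimLaw ν) (hθ : 0 < θ)
    (hk : 2 ≤ k) (hM : HasExpMoment ν θ R k) : expMoment ν θ R 2 ≤ 1 + expMoment ν θ R k := by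
  have := h.isProbabilityMeasure_tiltedLaw hν hθ
  have hM2 := h.hasExpMoment_two hν hθ hk hM
  rw [h.hasExpMoment_iff hν hθ] at hM hM2
  rw [h.expMoment_eq hν hθ, h.expMoment_eq hν hθ]
  calc _ ≤ ∫ x, (1 + x ^ k) ∂tiltedLaw ν θ R := by
        refine integral_mono_ae hM2 ((integrable_const _).add hM) ?_
        filter_upwards [ae_pos_tiltedLaw] with x hx
        exact sq_le_one_add_pow hx.le hk
    _ = _ := by rw [integral_add (integrable_const _) hM]; simp

theorem integrable_id (h : IsAdjustmentCoefficient ν θ R) (hν : IsClaimLaw ν) (hθ : 0 < θ)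
    (h2 : HasExpMoment ν θ R 2) : Integrable (fun x => x) (tiltedLaw ν θ R) := by
  have := h.isProbabilityMeasure_tiltedLaw hν hθ
  exact integrable_id_of_integrable_sq ((h.hasExpMoment_iff hν hθ 2).1 h2)

theorem expMoment_nonneg (h : IsAdjustmentCoefficient ν θ R) (hν : IsClaimLaw ν) (hθ : 0 < θ)
    (j : ℕ) : 0 ≤ expMoment ν θ R j := by
  rw [h.expMoment_eq hν hθ]
  exact integral_nonneg_of_ae (ae_pos_tiltedLaw.mono fun x hx => pow_nonneg (le_of_lt hx) j)

theorem expMoment_one_pos (h : IsAdjustmentCoefficient ν θ R) (hν : IsClaimLaw ν) (hθ : 0 < θ)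
    (h2 : HasExpMoment ν θ R 2) : 0 < expMoment ν θ R 1 := by
  have := h.isProbabilityMeasure_tiltedLaw hν hθ
  rw [h.expMoment_eq hν hθ]
  simp only [pow_one]
  exact integral_pos_of_ae_pos (h.integrable_id hν hθ h2) ae_pos_tiltedLaw

theorem integrable_exp_neg (h : IsAdjustmentCoefficient ν θ R) (hν : IsClaimLaw ν) (hθ : 0 < θ) :
    Integrable (fun x => Real.exp (-(R * x))) (tiltedLaw ν θ R) := by
  have := h.isProbabilityMeasure_tiltedLaw hν hθ
  refine (integrable_const (1 : ℝ)).mono' (by fun_prop) ?_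
  filter_upwards [ae_pos_tiltedLaw] with x hx
  rw [Real.norm_eq_abs, abs_of_pos (Real.exp_pos _), Real.exp_le_one_iff]
  have := mul_pos h.1 hx
  linarith

theorem exp_neg_mul_le (h : IsAdjustmentCoefficient ν θ R) {x : ℝ} (hx : 0 < x) :
    Real.exp (-(R * x)) * x ≤ x := by
  have := mul_pos h.1 hx
  have h1 : Real.exp (-(R * x)) ≤ 1 := Real.exp_le_one_iff.2 (by linarith)
  exact mul_le_of_le_one_left hx.le h1

theorem integrable_exp_neg_mul (h : IsAdjustmentCoefficient ν θ R) (hν : IsClaimLaw ν)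
    (hθ : 0 < θ) (h2 : HasExpMoment ν θ R 2) :
    Integrable (fun x => Real.exp (-(R * x)) * x) (tiltedLaw ν θ R) := by
  refine (h.integrable_id hν hθ h2).mono' (by fun_prop) ?_
  filter_upwards [ae_pos_tiltedLaw] with x hx
  rw [Real.norm_eq_abs, abs_of_nonneg (by positivity)]
  exact h.exp_neg_mul_le hx

theorem integral_exp_neg (h : IsAdjustmentCoefficient ν θ R) (hν : IsClaimLaw ν) (hθ : 0 < θ) :
    ∫ x, Real.exp (-(R * x)) ∂tiltedLaw ν θ R = 1 / (1 + θ) := by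
  have h1 := h.integral_tiltedLaw_exp_neg_mul hν hθ fun _ => 1
  simp only [mul_one, one_mul] at h1
  have := h.claimMoment_one_pos hν
  rw [h1, ← hν.claimMoment_one_eq]
  field_simp

theorem integral_exp_neg_mul (h : IsAdjustmentCoefficient ν θ R) (hν : IsClaimLaw ν) (hθ : 0 < θ) :
    ∫ x, Real.exp (-(R * x)) * x ∂tiltedLaw ν θ R =
      claimMoment ν 2 / (2 * claimMoment ν 1 * (1 + θ)) := by
  have := h.claimMoment_one_pos hν
  rw [h.integral_tiltedLaw_exp_neg_mul hν hθ fun x => x, hν.claimMoment_two_eq]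
  field_simp

theorem claimMoment_two_pos (h : IsAdjustmentCoefficient ν θ R) (hν : IsClaimLaw ν) (hθ : 0 < θ)
    (h2 : HasExpMoment ν θ R 2) : 0 < claimMoment ν 2 := by
  have := h.isProbabilityMeasure_tiltedLaw hν hθ
  have hm := h.claimMoment_one_pos hν
  have h1 := integral_pos_of_ae_pos (h.integrable_exp_neg_mul hν hθ h2)
    (ae_pos_tiltedLaw.mono fun x hx => by positivity)
  rw [h.integral_exp_neg_mul hν hθ] at h1
  exact (div_pos_iff_of_pos_right (by positivity)).1 h1

theorem le_expMoment_one (h : IsAdjustmentCoefficient ν θ R) (hν : IsClaimLaw ν) (hθ : 0 < θ)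
    (h2 : HasExpMoment ν θ R 2) :
    claimMoment ν 2 / (2 * claimMoment ν 1 * (1 + θ)) ≤ expMoment ν θ R 1 := by
  rw [← h.integral_exp_neg_mul hν hθ, h.expMoment_eq hν hθ]
  simp only [pow_one]
  refine integral_mono_ae (h.integrable_exp_neg_mul hν hθ h2) (h.integrable_id hν hθ h2) ?_
  filter_upwards [ae_pos_tiltedLaw] with x hx
  exact h.exp_neg_mul_le hx

/-- Integrate `(1 + Rx) exp(-Rx) ≤ 1` against the tilted law; both terms on the left are explicit in
`θ`, `m₁`, `m₂`. -/
theorem le_two_mul_div (h : IsAdjustmentCoefficient ν θ R) (hν : IsClaimLaw ν) (hθ : 0 < θ)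
    (h2 : HasExpMoment ν θ R 2) : R ≤ 2 * claimMoment ν 1 * θ / claimMoment ν 2 := by
  have := h.isProbabilityMeasure_tiltedLaw hν hθ
  have hm1 := h.claimMoment_one_pos hν
  have hm2 := h.claimMoment_two_pos hν hθ h2
  have i1 := h.integrable_exp_neg hν hθ
  have i2 := (h.integrable_exp_neg_mul hν hθ h2).const_mul R
  have h1 : ∫ x, (Real.exp (-(R * x)) + R * (Real.exp (-(R * x)) * x)) ∂tiltedLaw ν θ R ≤
      ∫ _, 1 ∂tiltedLaw ν θ R := by
    refine integral_mono (i1.add i2) (integrable_const 1) fun x => ?_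
    have h3 := Real.add_one_le_exp (R * x)
    calc Real.exp (-(R * x)) + R * (Real.exp (-(R * x)) * x)
        = Real.exp (-(R * x)) * (R * x + 1) := by ring
      _ ≤ Real.exp (-(R * x)) * Real.exp (R * x) := by gcongr
      _ = 1 := by rw [← Real.exp_add]; simp
  rw [integral_add i1 i2, integral_const_mul, h.integral_exp_neg hν hθ,
    h.integral_exp_neg_mul hν hθ] at h1
  simp only [integral_const, probReal_univ, one_smul] at h1
  have h4 : 1 / (1 + θ) + R * (claimMoment ν 2 / (2 * claimMoment ν 1 * (1 + θ))) =
      (2 * claimMoment ν 1 + R * claimMoment ν 2) / (2 * claimMoment ν 1 * (1 + θ)) := by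
    field_simp
  rw [h4, div_le_one (by positivity)] at h1
  rw [le_div_iff₀ hm2]
  linarith

/-- This is the estimate `RL = O(θ)`. The constant `20 = 2 · 5 · 2` combines the bound for `R`, the
constant of the overshoot bound and the lower bound for the tilted mean. -/
theorem mul_ratio_le (h : IsAdjustmentCoefficient ν θ R) (hν : IsClaimLaw ν) (hθ : 0 < θ)
    (hk : 2 ≤ k) (hM : HasExpMoment ν θ R k) :
    R * (5 * expMoment ν θ R 2 / expMoment ν θ R 1) ≤
      20 * claimMoment ν 1 ^ 2 * (1 + expMoment ν θ R k) * (1 + θ) / claimMoment ν 2 ^ 2 * θ := by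
  have h2 := h.hasExpMoment_two hν hθ hk hM
  have hm1 := h.claimMoment_one_pos hν
  have hm2 := h.claimMoment_two_pos hν hθ h2
  have hs := h.expMoment_nonneg hν hθ 2
  have hk0 := h.expMoment_nonneg hν hθ k
  have hm := h.expMoment_one_pos hν hθ h2
  calc R * (5 * expMoment ν θ R 2 / expMoment ν θ R 1)
      ≤ 2 * claimMoment ν 1 * θ / claimMoment ν 2 * (5 * (1 + expMoment ν θ R k) /
          (claimMoment ν 2 / (2 * claimMoment ν 1 * (1 + θ)))) := by
        gcongr
        · exact h.le_two_mul_div hν hθ h2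
        · exact h.expMoment_two_le hν hθ hk hM
        · exact h.le_expMoment_one hν hθ h2
    _ = _ := by field_simp; ring

/-- Rewrites the numerator of `α` as a mean under the tilted law, so that expanding `exp(-Rx)`
compares it with the denominator `R E_γ Y`. -/
theorem div_one_add_eq (h : IsAdjustmentCoefficient ν θ R) (hν : IsClaimLaw ν) (hθ : 0 < θ) :
    θ / (1 + θ) = ∫ x, (1 - Real.exp (-(R * x))) ∂tiltedLaw ν θ R := by
  have := h.isProbabilityMeasure_tiltedLaw hν hθ
  rw [integral_sub (integrable_const _) (h.integrable_exp_neg hν hθ), h.integral_exp_neg hν hθ]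
  simp only [integral_const, probReal_univ, one_smul]
  field_simp
  ring

theorem div_one_add_le (h : IsAdjustmentCoefficient ν θ R) (hν : IsClaimLaw ν) (hθ : 0 < θ)
    (h2 : HasExpMoment ν θ R 2) : θ / (1 + θ) ≤ R * expMoment ν θ R 1 := by
  have := h.isProbabilityMeasure_tiltedLaw hν hθ
  rw [h.div_one_add_eq hν hθ, h.expMoment_eq hν hθ, ← integral_const_mul]
  simp only [pow_one]
  refine integral_mono ((integrable_const _).sub (h.integrable_exp_neg hν hθ))
    ((h.integrable_id hν hθ h2).const_mul R) fun x => ?_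
  have := Real.add_one_le_exp (-(R * x))
  simp only
  linarith

theorem le_div_one_add (h : IsAdjustmentCoefficient ν θ R) (hν : IsClaimLaw ν) (hθ : 0 < θ)
    (h2 : HasExpMoment ν θ R 2) :
    R * expMoment ν θ R 1 - R ^ 2 * expMoment ν θ R 2 ≤ θ / (1 + θ) := by
  have := h.isProbabilityMeasure_tiltedLaw hν hθ
  have i1 := (h.integrable_id hν hθ h2).const_mul R
  have i2 := ((h.hasExpMoment_iff hν hθ 2).1 h2).const_mul (R ^ 2)
  rw [h.div_one_add_eq hν hθ, h.expMoment_eq hν hθ, h.expMoment_eq hν hθ, ← integral_const_mul,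
    ← integral_const_mul]
  simp only [pow_one]
  rw [← integral_sub i1 i2]
  refine integral_mono_ae (i1.sub i2) ((integrable_const _).sub (h.integrable_exp_neg hν hθ)) ?_
  filter_upwards [ae_pos_tiltedLaw] with x hx
  have := exp_neg_le_one_sub_add_sq (mul_pos h.1 hx).le
  rw [mul_pow] at this
  linarith

theorem integral_mul_exp_mul_density (hθ : 0 < θ) :
    ∫ x in Ioi 0, x * Real.exp (R * x) * integratedTailDensity ν x =
      (1 + θ) * expMoment ν θ R 1 := by
  rw [expMoment, ← integral_const_mul]
  congr 1; ext x
  field_simp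

/-! ### Comparison of the tilted laws at two safety loadings -/

theorem integral_tiltedLaw_exp_sub (h : IsAdjustmentCoefficient ν θ R) (hν : IsClaimLaw ν)
    (hθ : 0 < θ) {θ₀ R₀ : ℝ} (h₀ : IsAdjustmentCoefficient ν θ₀ R₀) (hθ₀ : 0 < θ₀) (f : ℝ → ℝ) :
    ∫ x, Real.exp ((R₀ - R) * x) * f x ∂tiltedLaw ν θ R =
      (1 + θ₀) / (1 + θ) * ∫ x, f x ∂tiltedLaw ν θ₀ R₀ := by
  rw [h.integral_tiltedLaw hν hθ, h₀.integral_tiltedLaw hν hθ₀, ← integral_const_mul]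
  congr 1; ext x
  have : Real.exp (R₀ * x) = Real.exp (R * x) * Real.exp ((R₀ - R) * x) := by
    rw [← Real.exp_add]; ring_nf
  rw [this]
  field_simp

theorem integrable_exp_sub_mul (h : IsAdjustmentCoefficient ν θ R) (hν : IsClaimLaw ν)
    (hθ : 0 < θ) {θ₀ R₀ : ℝ} (h₀ : IsAdjustmentCoefficient ν θ₀ R₀) (hθ₀ : 0 < θ₀) {f : ℝ → ℝ}
    (hf : Integrable f (tiltedLaw ν θ₀ R₀)) :
    Integrable (fun x => Real.exp ((R₀ - R) * x) * f x) (tiltedLaw ν θ R) := by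
  rw [h₀.integrable_tiltedLaw_iff hν hθ₀] at hf
  rw [h.integrable_tiltedLaw_iff hν hθ]
  refine (hf.const_mul ((1 + θ₀) / (1 + θ))).congr (Filter.Eventually.of_forall fun x => ?_)
  have : Real.exp (R₀ * x) = Real.exp (R * x) * Real.exp ((R₀ - R) * x) := by
    rw [← Real.exp_add]; ring_nf
  simp only
  rw [this]
  field_simp

/-- The adjustment coefficient is monotone in the safety loading. -/
theorem le_of_le (h : IsAdjustmentCoefficient ν θ R) (hν : IsClaimLaw ν) (hθ : 0 < θ) {θ₀ R₀ : ℝ}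
    (h₀ : IsAdjustmentCoefficient ν θ₀ R₀) (hle : θ ≤ θ₀) : R ≤ R₀ := by
  by_contra! hlt
  have hθ₀ : 0 < θ₀ := hθ.trans_le hle
  have := h.isProbabilityMeasure_tiltedLaw hν hθ
  have := h₀.isProbabilityMeasure_tiltedLaw hν hθ₀
  have h1 := h.integral_tiltedLaw_exp_sub hν hθ h₀ hθ₀ fun _ => 1
  have i1 := h.integrable_exp_sub_mul hν hθ h₀ hθ₀ (integrable_const 1)
  -- If `R₀ < R`, the mean of `exp((R₀ - R)x)` under the tilted law is below `1`, whereas it equals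
  -- `(1+θ₀)/(1+θ) ≥ 1`.
  have h2 := integral_pos_of_ae_pos ((integrable_const (1 : ℝ)).sub i1) (by
    filter_upwards [ae_pos_tiltedLaw] with x hx
    have : Real.exp ((R₀ - R) * x) < 1 := Real.exp_lt_one_iff.2 (by nlinarith)
    simp only [Pi.sub_apply, mul_one]
    linarith)
  simp only [Pi.sub_apply] at h2
  rw [integral_sub (integrable_const _) i1, h1] at h2
  simp only [integral_const, probReal_univ, one_smul, mul_one] at h2
  have : 1 ≤ (1 + θ₀) / (1 + θ) := by rw [one_le_div (by linarith)]; linarith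
  linarith

theorem expMoment_le_of_le (h : IsAdjustmentCoefficient ν θ R) (hν : IsClaimLaw ν) (hθ : 0 < θ)
    (hM : HasExpMoment ν θ R k) {θ₀ R₀ : ℝ} (h₀ : IsAdjustmentCoefficient ν θ₀ R₀)
    (hM₀ : HasExpMoment ν θ₀ R₀ k) (hle : θ ≤ θ₀) :
    expMoment ν θ R k ≤ (1 + θ₀) * expMoment ν θ₀ R₀ k := by
  have hθ₀ : 0 < θ₀ := hθ.trans_le hle
  have hR := h.le_of_le hν hθ h₀ hle
  have h0 := h₀.expMoment_nonneg hν hθ₀ k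
  rw [h.hasExpMoment_iff hν hθ] at hM
  rw [h₀.hasExpMoment_iff hν hθ₀] at hM₀
  calc expMoment ν θ R k = ∫ x, x ^ k ∂tiltedLaw ν θ R := h.expMoment_eq hν hθ k
    _ ≤ ∫ x, Real.exp ((R₀ - R) * x) * x ^ k ∂tiltedLaw ν θ R := by
        refine integral_mono_ae hM (h.integrable_exp_sub_mul hν hθ h₀ hθ₀ hM₀) ?_
        filter_upwards [ae_pos_tiltedLaw] with x hx
        exact le_mul_of_one_le_left (by positivity)
          (Real.one_le_exp (mul_nonneg (by linarith) hx.le))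
    _ = (1 + θ₀) / (1 + θ) * expMoment ν θ₀ R₀ k := by
        rw [h.integral_tiltedLaw_exp_sub hν hθ h₀ hθ₀, h₀.expMoment_eq hν hθ₀]
    _ ≤ _ := by
        gcongr
        exact div_le_self (by linarith) (by linarith)

end IsAdjustmentCoefficient

/-! ### Error bounds for the Cramér–Lundberg approximation -/

namespace RiskModel

variable {Ω : Type*} [MeasurableSpace Ω] {P : Measure Ω} {ν : Measure ℝ} {R : ℝ} {k : ℕ}

/-- Here `α = (θ/(1+θ)) / (Rm)`, and the expansion of `exp(-Rx)` to second order gives `1 - Rs/m ≤ α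
≤ 1`. The factor `5` weakens the lower bound to match the one for the ruin probability. -/
theorem cramerLundberg_bounds (X : RiskModel P ν) (hν : IsClaimLaw ν)
    (hθ : 0 < X.safetyLoading) (h : IsAdjustmentCoefficient ν X.safetyLoading R)
    (h2 : HasExpMoment ν X.safetyLoading R 2) (u : ℝ) :
    0 ≤ X.cramerLundberg R u ∧ X.cramerLundberg R u ≤ Real.exp (-R * u) ∧
      (1 - R * (5 * expMoment ν X.safetyLoading R 2 / expMoment ν X.safetyLoading R 1)) *
        Real.exp (-R * u) ≤ X.cramerLundberg R u := by
  have hR := h.1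
  have hm := h.expMoment_one_pos hν hθ h2
  have hs := h.expMoment_nonneg hν hθ 2
  have hu := h.div_one_add_le hν hθ h2
  have hl := h.le_div_one_add hν hθ h2
  rw [cramerLundberg, IsAdjustmentCoefficient.integral_mul_exp_mul_density hθ]
  set θ := X.safetyLoading
  set m := expMoment ν θ R 1
  set s := expMoment ν θ R 2
  have e : θ / (R * ((1 + θ) * m)) = θ / (1 + θ) / (R * m) := by field_simp
  rw [e]
  refine ⟨by positivity, ?_, ?_⟩
  · exact mul_le_of_le_one_left (Real.exp_nonneg _) ((div_le_one (by positivity)).2 hu)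
  · refine mul_le_mul_of_nonneg_right ?_ (Real.exp_nonneg _)
    calc 1 - R * (5 * s / m) ≤ 1 - R * (s / m) := by
          gcongr
          linarith
      _ = (R * m - R ^ 2 * s) / (R * m) := by field_simp
      _ ≤ _ := by gcongr

/-- The error bounds, with a constant that depends on the moments only. -/
theorem error_bounds [IsProbabilityMeasure P] (X : RiskModel P ν) (hν : IsClaimLaw ν)
    (hθ : 0 < X.safetyLoading) (h : IsAdjustmentCoefficient ν X.safetyLoading R)
    (hk : 2 ≤ k) (hM : HasExpMoment ν X.safetyLoading R k) {K θmax : ℝ} (hK0 : 0 ≤ K)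
    (hK : 20 * claimMoment ν 1 ^ 2 * (1 + expMoment ν X.safetyLoading R k) *
      (1 + X.safetyLoading) / claimMoment ν 2 ^ 2 ≤ K)
    (hmax : X.safetyLoading ≤ θmax) {u : ℝ} (hu : 0 ≤ u) :
    |X.ruinProb u - Real.exp (-R * u)| ≤
        K * Real.exp (K * θmax) * X.safetyLoading * Real.exp (-R * u) ∧
      |X.ruinProb u - X.cramerLundberg R u| ≤
        K * Real.exp (K * θmax) * X.safetyLoading * Real.exp (-R * u) ∧
      |(X.ruinProb u - X.cramerLundberg R u) / X.ruinProb u| ≤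
        K * Real.exp (K * θmax) * X.safetyLoading := by
  have h2 := h.hasExpMoment_two hν hθ hk hM
  obtain ⟨hl, hup⟩ := X.ruinProb_bounds hν hθ h h2 (h.expMoment_one_pos hν hθ h2) hu
  obtain ⟨-, hcu, hcl⟩ := X.cramerLundberg_bounds hν hθ h h2 u
  have hB := (h.mul_ratio_le hν hθ hk hM).trans (mul_le_mul_of_nonneg_right hK hθ.le)
  set B := R * (5 * expMoment ν X.safetyLoading R 2 / expMoment ν X.safetyLoading R 1)
  set E := Real.exp (-R * u) with hE
  have hE0 : 0 < E := Real.exp_pos _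
  have hKθ : 0 ≤ K * X.safetyLoading := mul_nonneg hK0 hθ.le
  have h1 : (1 - K * X.safetyLoading) * E ≤ X.ruinProb u := by
    refine le_trans ?_ hl
    gcongr
    linarith [Real.add_one_le_exp (-B)]
  have h3 : (1 - K * X.safetyLoading) * E ≤ X.cramerLundberg R u := by
    refine le_trans ?_ hcl
    gcongr
  have h4 : K * X.safetyLoading * E ≤ K * Real.exp (K * θmax) * X.safetyLoading * E := by
    have h5 : 1 ≤ Real.exp (K * θmax) :=
      Real.one_le_exp (mul_nonneg hK0 (hθ.le.trans hmax))
    gcongr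
    exact le_mul_of_one_le_right hK0 h5
  -- Both quantities lie in the interval from `(1 - Kθ)E` to `E`.
  have h6 : |X.ruinProb u - X.cramerLundberg R u| ≤ K * X.safetyLoading * E := by
    rw [abs_le]; constructor <;> linarith
  refine ⟨?_, h6.trans h4, ?_⟩
  · refine le_trans ?_ h4
    rw [abs_le]; constructor <;> linarith
  -- The linear lower bound `1 - Kθ` may be negative, so division by the ruin probability uses the
  -- exponential one; this is the origin of the factor `exp(K θmax)`.
  · have hlow : Real.exp (-(K * θmax)) * E ≤ X.ruinProb u := by
      refine le_trans ?_ hl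
      gcongr
      exact hB.trans (mul_le_mul_of_nonneg_left hmax hK0)
    have hpos : 0 < X.ruinProb u := lt_of_lt_of_le (by positivity) hlow
    rw [abs_div, abs_of_pos hpos, div_le_iff₀ hpos]
    calc _ ≤ K * X.safetyLoading * E := h6
      _ = K * Real.exp (K * θmax) * X.safetyLoading * (Real.exp (-(K * θmax)) * E) := by
        rw [Real.exp_neg]
        field_simp
      _ ≤ _ := by gcongr

theorem ruinProb_pos [IsProbabilityMeasure P] (X : RiskModel P ν) (hν : IsClaimLaw ν)
    (hθ : 0 < X.safetyLoading) (h : IsAdjustmentCoefficient ν X.safetyLoading R)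
    (h2 : HasExpMoment ν X.safetyLoading R 2) {u : ℝ} (hu : 0 ≤ u) : 0 < X.ruinProb u :=
  lt_of_lt_of_le (by positivity)
    (X.ruinProb_bounds hν hθ h h2 (h.expMoment_one_pos hν hθ h2) hu).1

/-- The error bounds for the safety loadings below one at which the exponential moment exists. -/
theorem error_bounds_of_le [IsProbabilityMeasure P] (X : RiskModel P ν) (hν : IsClaimLaw ν)
    (hθ : 0 < X.safetyLoading) (h : IsAdjustmentCoefficient ν X.safetyLoading R)
    (hk : 2 ≤ k) (hM : HasExpMoment ν X.safetyLoading R k) {θ₀ R₀ K : ℝ}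
    (h₀ : IsAdjustmentCoefficient ν θ₀ R₀) (hM₀ : HasExpMoment ν θ₀ R₀ k)
    (hK : K = 20 * claimMoment ν 1 ^ 2 * (1 + (1 + θ₀) * expMoment ν θ₀ R₀ k) *
      (1 + θ₀) / claimMoment ν 2 ^ 2)
    (hle : X.safetyLoading ≤ θ₀) {u : ℝ} (hu : 0 ≤ u) :
    |X.ruinProb u - Real.exp (-R * u)| ≤
        K * Real.exp (K * θ₀) * X.safetyLoading * Real.exp (-R * u) ∧
      |X.ruinProb u - X.cramerLundberg R u| ≤
        K * Real.exp (K * θ₀) * X.safetyLoading * Real.exp (-R * u) ∧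
      |(X.ruinProb u - X.cramerLundberg R u) / X.ruinProb u| ≤
        K * Real.exp (K * θ₀) * X.safetyLoading := by
  have hθ₀ : 0 < θ₀ := hθ.trans_le hle
  have h1 := h.expMoment_le_of_le hν hθ hM h₀ hM₀ hle
  have h3 := h₀.expMoment_nonneg hν hθ₀ k
  have h4 := h.expMoment_nonneg hν hθ k
  have hK' : 20 * claimMoment ν 1 ^ 2 * (1 + expMoment ν X.safetyLoading R k) *
      (1 + X.safetyLoading) / claimMoment ν 2 ^ 2 ≤ K := by
    rw [hK]; gcongr
  exact X.error_bounds hν hθ h hk hM (le_trans (by positivity) hK') hK' hle hu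

end RiskModel

end RuinTheory

/-! ### The uniform bounds and the case of a fixed claim law -/

theorem mainTheorem5 :
    -- the constant depends only on `k`, the range of `θ`, the moments `m₁`, `m₂`, and bounds on
    -- `m_k^exp` and `h_I`
    (∀ (k : ℕ) (_ : 2 ≤ k) (θmax m₁ m₂ M H : ℝ),
      ∃ C : ℝ, 0 ≤ C ∧
        ∀ (ν : Measure ℝ) (Ω : Type*) [MeasurableSpace Ω] (P : Measure Ω) [IsProbabilityMeasure P]
          (X : RuinTheory.RiskModel P ν) (R : ℝ),
          RuinTheory.IsClaimLaw ν →
          RuinTheory.claimMoment ν 1 = m₁ → RuinTheory.claimMoment ν 2 = m₂ →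
          0 < X.safetyLoading → X.safetyLoading ≤ θmax →
          RuinTheory.IsAdjustmentCoefficient ν X.safetyLoading R →
          RuinTheory.HasExpMoment ν X.safetyLoading R k →
          RuinTheory.expMoment ν X.safetyLoading R k ≤ M →
          RuinTheory.HasBoundedHazard ν → RuinTheory.hazardSup ν ≤ H →
          ∀ u : ℝ, 0 ≤ u →
            |X.ruinProb u - Real.exp (-R * u)| ≤ C * X.safetyLoading * Real.exp (-R * u) ∧
            |X.ruinProb u - X.cramerLundberg R u| ≤ C * X.safetyLoading * Real.exp (-R * u) ∧
            0 < X.ruinProb u ∧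
            |(X.ruinProb u - X.cramerLundberg R u) / X.ruinProb u| ≤ C * X.safetyLoading) ∧
    -- for a fixed claim law, the constant is uniform over the safety loadings in `(0, θmax]`
    (∀ (k : ℕ) (_ : 2 ≤ k) (ν : Measure ℝ) (_ : RuinTheory.IsClaimLaw ν)
      (_ : RuinTheory.HasBoundedHazard ν) (θmax : ℝ),
      ∃ C : ℝ, 0 ≤ C ∧
        ∀ (Ω : Type*) [MeasurableSpace Ω] (P : Measure Ω) [IsProbabilityMeasure P]
          (X : RuinTheory.RiskModel P ν) (R : ℝ),
          0 < X.safetyLoading → X.safetyLoading ≤ θmax →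
          RuinTheory.IsAdjustmentCoefficient ν X.safetyLoading R →
          RuinTheory.HasExpMoment ν X.safetyLoading R k →
          ∀ u : ℝ, 0 ≤ u →
            |X.ruinProb u - Real.exp (-R * u)| ≤ C * X.safetyLoading * Real.exp (-R * u) ∧
            |X.ruinProb u - X.cramerLundberg R u| ≤ C * X.safetyLoading * Real.exp (-R * u) ∧
            0 < X.ruinProb u ∧
            ((∃ Rmax : ℝ, RuinTheory.IsAdjustmentCoefficient ν θmax Rmax ∧
                RuinTheory.HasExpMoment ν θmax Rmax k) →
              |(X.ruinProb u - X.cramerLundberg R u) / X.ruinProb u| ≤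
                C * X.safetyLoading)) := by
  refine ⟨fun k hk θmax m₁ m₂ M H => ?_, fun k hk ν hν _ θmax => ?_⟩
  -- The absolute values keep `K` nonnegative for arbitrary real parameters, including those that no
  -- model satisfies.
  · set K := 20 * m₁ ^ 2 * (1 + |M|) * (1 + |θmax|) / m₂ ^ 2 with hKdef
    have hK0 : 0 ≤ K := by positivity
    refine ⟨K * Real.exp (K * θmax), by positivity, ?_⟩
    intro ν Ω _ P _ X R hν hm₁ hm₂ hθ hmax h hM hMle _ _ u hu
    have h4 := h.expMoment_nonneg hν hθ k
    have hK : 20 * RuinTheory.claimMoment ν 1 ^ 2 *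
        (1 + RuinTheory.expMoment ν X.safetyLoading R k) *
        (1 + X.safetyLoading) / RuinTheory.claimMoment ν 2 ^ 2 ≤ K := by
      rw [hm₁, hm₂, hKdef]
      gcongr
      exacts [hMle.trans (le_abs_self M), hmax.trans (le_abs_self θmax)]
    obtain ⟨ha, hb, hc⟩ := X.error_bounds hν hθ h hk hM hK0 hK hmax hu
    exact ⟨ha, hb, X.ruinProb_pos hν hθ h (h.hasExpMoment_two hν hθ hk hM) hu, hc⟩
  -- A reference loading `θ₀` is chosen independently of the model. The last clause forces `θ₀ ≥
  -- θmax` when the assumptions hold at `θmax`, so that the relative bound is never needed beyond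
  -- `θ₀`.
  · by_cases hex : ∃ θ₀ R₀ : ℝ, 0 < θ₀ ∧ RuinTheory.IsAdjustmentCoefficient ν θ₀ R₀ ∧
        RuinTheory.HasExpMoment ν θ₀ R₀ k ∧
        ((∃ Rmax : ℝ, RuinTheory.IsAdjustmentCoefficient ν θmax Rmax ∧
          RuinTheory.HasExpMoment ν θmax Rmax k) → θmax ≤ θ₀)
    · obtain ⟨θ₀, R₀, hθ₀, h₀, hM₀, hmax₀⟩ := hex
      set K := 20 * RuinTheory.claimMoment ν 1 ^ 2 *
        (1 + (1 + θ₀) * RuinTheory.expMoment ν θ₀ R₀ k) * (1 + θ₀) /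
          RuinTheory.claimMoment ν 2 ^ 2 with hK
      refine ⟨max (K * Real.exp (K * θ₀)) (1 / θ₀), le_max_of_le_right (by positivity), ?_⟩
      intro Ω _ P _ X R hθ hmax h hM u hu
      have h2 := h.hasExpMoment_two hν hθ hk hM
      have hpos := X.ruinProb_pos hν hθ h h2 hu
      have hE := Real.exp_pos (-R * u)
      rcases le_or_gt X.safetyLoading θ₀ with hle | hlt
      · obtain ⟨ha, hb, hc⟩ := X.error_bounds_of_le hν hθ h hk hM h₀ hM₀ hK hle hu
        have hC := le_max_left (K * Real.exp (K * θ₀)) (1 / θ₀)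
        exact ⟨ha.trans (by gcongr), hb.trans (by gcongr), hpos, fun _ => hc.trans (by gcongr)⟩
      -- Beyond `θ₀`, both `ψ` and `ψ^CL` lie in `[0, exp(-Ru)]`, and `C θ ≥ θ/θ₀ > 1` makes the
      -- absolute bounds trivial.
      · have hup := (X.ruinProb_bounds hν hθ h h2 (h.expMoment_one_pos hν hθ h2) hu).2
        obtain ⟨hc0, hc1, -⟩ := X.cramerLundberg_bounds hν hθ h h2 u
        have hone : Real.exp (-R * u) ≤
            max (K * Real.exp (K * θ₀)) (1 / θ₀) * X.safetyLoading * Real.exp (-R * u) := by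
          refine le_mul_of_one_le_left hE.le ?_
          calc (1 : ℝ) = 1 / θ₀ * θ₀ := by field_simp
            _ ≤ max (K * Real.exp (K * θ₀)) (1 / θ₀) * X.safetyLoading := by
                gcongr
                exact le_max_right _ _
        refine ⟨le_trans ?_ hone, le_trans ?_ hone, hpos, fun hR => ?_⟩
        · rw [abs_le]; constructor <;> linarith
        · rw [abs_le]; constructor <;> linarith
        · exact absurd (hmax.trans (hmax₀ hR)) hlt.not_ge
    -- Without a reference loading no model satisfies the assumptions: either `θmax` or the loading
    -- of the model itself would be one.
    · refine ⟨0, le_rfl, ?_⟩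
      intro Ω _ P _ X R hθ hmax h hM u hu
      exfalso
      by_cases hR : ∃ Rmax : ℝ, RuinTheory.IsAdjustmentCoefficient ν θmax Rmax ∧
          RuinTheory.HasExpMoment ν θmax Rmax k
      · obtain ⟨Rmax, h₁, h₂⟩ := hR
        exact hex ⟨θmax, Rmax, hθ.trans_le hmax, h₁, h₂, fun _ => le_rfl⟩
      · exact hex ⟨X.safetyLoading, R, hθ, h, hM, fun h' => absurd h' hR⟩
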